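/- **Conventions.** A graph of groups $\mathcal G$ consists of a connected graph, vertex groups $G_v$, edge groups $G_e$, and injective homomorphisms from each edge group into the vertex groups at the two ends of the edge. Write $\pi_1(\mathcal G)$ for its fundamental group (equivalently, the fundamental group of the geometric realization $G$ of an associated graph of spaces) and $H_1(G)=\pi_1(\mathcal G)^{\mathrm{ab}}$ for the first homology of that realization. A *finite cover* $\mathcal C\to\mathcal B$ of graphs of groups is a map of graphs of groups, with $\mathcal C$ connected, given by a graph map, injective homomorphisms $H_u\to G_v$ ($u$ over $v$) and $H_f\to G_e$ ($f$ over $e$) that commute with the edge maps up to conjugation in the groups $G_v$, such that for every vertex $u$ over $v$ and every edge $e$ at $v$, the edge maps $H_f\to H_u$ of the edges $f$ at $u$ over $e$ are precisely all the elevations of $G_e\to G_v$ to $H_u$, one edge for each elevation (that is, the conjugating elements $\delta_f\in G_v$ induce a bijection $\bigsqcup_f H_u/H_f\to G_v/G_e$, $hH_f\mapsto h\,\delta_f\,G_e$), and such that over every vertex $v$ there are finitely many vertices $u$, each with $[G_v:H_u]<\infty$. For $g\ge 1$ let $$\pi_1(\Sigma_{g,2})=\langle a_1,b_1,\dots,a_g,b_g,c_1,c_2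 \mid [a_1,b_1]\cdots[a_g,b_g]\,c_1c_2\rangle$$ be the fundamental group of the compact, connected, oriented surface $\Sigma_{g,2}$ of genus $g$ with two boundary components; $c_1,c_2$ represent the boundary components with the induced orientation. A *standard branched surface* is a graph of groups $\mathcal B$ with exactly five vertices: three surface vertices $\Sigma,\Theta,\Pi$, whose vertex groups are identified with $\pi_1(\Sigma_{g,2})$ for some genera $g_\Sigma,g_\Theta,g_\Pi\ge 1$, and two cyclic vertices $C_1,C_2$, whose vertex groups are infinite cyclic with a fixed generator (an orientation); there is exactly one edge between each surface vertex and each cyclic vertex, and there are no other edges; every edge map into a cyclic vertex group is an isomorphism; and, for each surface vertex, the edge to $C_1$ identifies the generator of $C_1$ with a conjugate of $c_1$ and the edge to $C_2$ identifies the generator of $C_2$ with a conjugate of $c_2^{-1}$. In other words, $\mathcal B$ is obtained from two oriented circles $C_1,C_2$ and three compact, connected, oriented surfaces of positive genus, each with two boundary components, by gluing so that $\partial[\Sigma]=\partial[\Theta]=\partial[\Pi]=C_1-C_2$. **Proposition.** Let $\mathcal B$ be a standard branched surface. For every finite abelian group $M$ there are a finite cover $\mathcal B_M$ of $\mathcal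 B$ and an integer $r\ge 0$ such that $$H_1(B_M)\cong M\oplus\mathbb Z^r .$$ -/

import Mathlib

universe u

/-- A graph of groups. The underlying graph is a (multi)graph in which every geometric edge
carries a chosen direction: `E v w` is the set of edges directed from `v` to `w`, so a pair
`{e, ē}` of mutually inverse edges in the sense of Serre is represented by one element.
Each edge `e : E v w` has an edge group `EG e` with injective homomorphisms into the vertex
groups at its two ends. The underlying graph is nonempty and connected (as an undirected graph). -/
structure GraphOfGroups where
  V : Type u
  E : V → V → Type u
  nonempty : Nonempty V
  connected : ∀ v w : V, Relation.EqvGen (fun a b => Nonempty (E a b)) v w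
  VG : V → Type u
  EG : ∀ {v w : V}, E v w → Type u
  [groupVG : ∀ v, Group (VG v)]
  [groupEG : ∀ {v w : V} (e : E v w), Group (EG e)]
  /-- the edge map into the vertex group at the initial vertex -/
  φι : ∀ {v w : V} (e : E v w), EG e →* VG v
  /-- the edge map into the vertex group at the terminal vertex -/
  φτ : ∀ {v w : V} (e : E v w), EG e →* VG w
  φι_injective : ∀ {v w : V} (e : E v w), Function.Injective (φι e)
  φτ_injective : ∀ {v w : V} (e : E v w), Function.Injective (φτ e)

namespace GraphOfGroups

attribute [instance] GraphOfGroups.groupVG GraphOfGroups.groupEG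

/-! ### The fundamental group of a graph of groups (following Serre) -/

section FundamentalGroup

variable (𝒢 : GraphOfGroups.{u})

/-- Generators of the path group: elements of the vertex groups, and one stable letter per edge. -/
inductive Gen
  | elt (v : 𝒢.V) (g : 𝒢.VG v)
  | edge {v w : 𝒢.V} (e : 𝒢.E v w)

/-- Defining relations of the path group: the multiplication in the vertex groups, and
`t_e φτ(x) t_e⁻¹ = φι(x)` for `x` in the edge group of `e`. -/
inductive Rel : FreeGroup 𝒢.Gen → Prop
  | mul (v : 𝒢.V) (g h : 𝒢.VG v) :
      Rel (FreeGroup.of (Gen.elt v g) * FreeGroup.of (Gen.elt v h) *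
        (FreeGroup.of (Gen.elt v (g * h)))⁻¹)
  | conj {v w : 𝒢.V} (e : 𝒢.E v w) (x : 𝒢.EG e) :
      Rel (FreeGroup.of (Gen.edge e) * FreeGroup.of (Gen.elt w (𝒢.φτ e x)) *
        (FreeGroup.of (Gen.edge e))⁻¹ * (FreeGroup.of (Gen.elt v (𝒢.φι e x)))⁻¹)

/-- The path group (Serre's `F(𝒢)`): the free product of all vertex groups and of the free group
on the edges, modulo the relations `t_e φτ(x) t_e⁻¹ = φι(x)`. -/
abbrev PathGroup : Type u := PresentedGroup {r : FreeGroup 𝒢.Gen | 𝒢.Rel r}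

/-- The class of an element of a vertex group in the path group. -/
def elt (v : 𝒢.V) (g : 𝒢.VG v) : 𝒢.PathGroup := PresentedGroup.of (Gen.elt v g)

/-- The stable letter of an edge. -/
def letter {v w : 𝒢.V} (e : 𝒢.E v w) : 𝒢.PathGroup := PresentedGroup.of (Gen.edge e)

/-- `𝒢.IsPath v w x`: the element `x` of the path group is represented by a path from `v` to `w`,
i.e. by a word `g₀ t₁ g₁ t₂ ⋯ tₙ gₙ` where `t₁, …, tₙ` are the letters (or inverses of letters) of
the successive edges of an edge path from `v` to `w`, and each `gᵢ` lies in the vertex group of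
the `i`-th vertex of that edge path. -/
inductive IsPath : 𝒢.V → 𝒢.V → 𝒢.PathGroup → Prop
  | elt (v : 𝒢.V) (g : 𝒢.VG v) : IsPath v v (𝒢.elt v g)
  | letter {v w : 𝒢.V} (e : 𝒢.E v w) : IsPath v w (𝒢.letter e)
  | letter_inv {v w : 𝒢.V} (e : 𝒢.E v w) : IsPath w v (𝒢.letter e)⁻¹
  | mul {u v w : 𝒢.V} {x y : 𝒢.PathGroup} (hx : IsPath u v x) (hy : IsPath v w y) :
      IsPath u w (x * y)

variable {𝒢}

theorem elt_mul (v : 𝒢.V) (g h : 𝒢.VG v) : 𝒢.elt v (g * h) = 𝒢.elt v g * 𝒢.elt v h := by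
  have := PresentedGroup.one_of_mem (rels := {r : FreeGroup 𝒢.Gen | 𝒢.Rel r}) (Rel.mul v g h)
  rw [map_mul, map_mul, map_inv, mul_inv_eq_one] at this
  exact this.symm

theorem elt_one (v : 𝒢.V) : 𝒢.elt v 1 = 1 := by
  have := elt_mul v (1 : 𝒢.VG v) 1
  rwa [mul_one, left_eq_mul] at this

theorem elt_inv (v : 𝒢.V) (g : 𝒢.VG v) : 𝒢.elt v g⁻¹ = (𝒢.elt v g)⁻¹ := by
  rw [eq_inv_iff_mul_eq_one, ← elt_mul, inv_mul_cancel, elt_one]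

theorem IsPath.inv {v w : 𝒢.V} {x : 𝒢.PathGroup} (h : 𝒢.IsPath v w x) : 𝒢.IsPath w v x⁻¹ := by
  induction h with
  | elt v g => rw [← elt_inv]; exact .elt v _
  | letter e => exact .letter_inv e
  | letter_inv e => rw [inv_inv]; exact .letter e
  | mul _ _ hx hy => rw [mul_inv_rev]; exact .mul hy hx

variable (𝒢)

/-- The fundamental group of the graph of groups `𝒢` based at the vertex `v₀`: the elements of
the path group represented by closed paths at `v₀`. -/
def π₁ (v₀ : 𝒢.V) : Subgroup 𝒢.PathGroup where
  carrier := {x | 𝒢.IsPath v₀ v₀ x}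
  mul_mem' hx hy := .mul hx hy
  one_mem' := by
    rw [Set.mem_ofPred_eq, ← elt_one v₀]
    exact .elt v₀ 1
  inv_mem' hx := hx.inv

/-- First homology of (the geometric realization of) `𝒢`: the abelianization of its fundamental
group, written additively. -/
abbrev H₁ (v₀ : 𝒢.V) : Type u := Additive (Abelianization (𝒢.π₁ v₀))

end FundamentalGroup

/-! ### Coverings of graphs of groups -/

/-- A covering `𝒞 → ℬ` of graphs of groups. It consists of a (direction preserving) graph map,
injective homomorphisms of vertex and edge groups, and, at either end of each edge `f` of `𝒞`,
an element `δ` of the corresponding vertex group of `ℬ` such that the edge map of `f` is the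
edge map of the image of `f` up to conjugation by `δ`.

The last two conditions say that the edge maps of `𝒞` at a vertex `u` are exactly all the
elevations of the edge maps of `ℬ` at the image `v` of `u`: elevations of `φ_e : G_e → G_v` to
`H_u ≤ G_v` correspond to the `H_u`-orbits on `G_v / φ_e(G_e)`, and these orbits are represented
once each by the edges `f` of `𝒞` at `u` lying over `e`, the orbit of `f` being
`H_u / φ_f(H_f)`. -/
structure Covering (𝒞 ℬ : GraphOfGroups.{u}) where
  onV : 𝒞.V → ℬ.V
  onE : ∀ {u w : 𝒞.V}, 𝒞.E u w → ℬ.E (onV u) (onV w)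
  onVG : ∀ u : 𝒞.V, 𝒞.VG u →* ℬ.VG (onV u)
  onEG : ∀ {u w : 𝒞.V} (f : 𝒞.E u w), 𝒞.EG f →* ℬ.EG (onE f)
  onVG_injective : ∀ u, Function.Injective (onVG u)
  onEG_injective : ∀ {u w : 𝒞.V} (f : 𝒞.E u w), Function.Injective (onEG f)
  δι : ∀ {u w : 𝒞.V}, 𝒞.E u w → ℬ.VG (onV u)
  δτ : ∀ {u w : 𝒞.V}, 𝒞.E u w → ℬ.VG (onV w)
  comm_ι : ∀ {u w : 𝒞.V} (f : 𝒞.E u w) (x : 𝒞.EG f),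
    onVG u (𝒞.φι f x) = δι f * ℬ.φι (onE f) (onEG f x) * (δι f)⁻¹
  comm_τ : ∀ {u w : 𝒞.V} (f : 𝒞.E u w) (x : 𝒞.EG f),
    onVG w (𝒞.φτ f x) = δτ f * ℬ.φτ (onE f) (onEG f x) * (δτ f)⁻¹
  /-- Edges starting at `u`: the map `(f, h φ_f(H_f)) ↦ (e, h δ_f φ_e(G_e))`, where `e` is the
  image of `f`, is (well defined and) bijective. -/
  bijective_ι : ∀ u : 𝒞.V, ∃ Φ : (Σ f : (Σ w, 𝒞.E u w), 𝒞.VG u ⧸ (𝒞.φι f.2).range) →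
      (Σ e : (Σ w, ℬ.E (onV u) w), ℬ.VG (onV u) ⧸ (ℬ.φι e.2).range),
    (∀ (w : 𝒞.V) (f : 𝒞.E u w) (h : 𝒞.VG u),
      Φ ⟨⟨w, f⟩, QuotientGroup.mk h⟩ =
        ⟨⟨onV w, onE f⟩, QuotientGroup.mk (onVG u h * δι f)⟩) ∧ Function.Bijective Φ
  /-- The same for the edges ending at `u`. -/
  bijective_τ : ∀ u : 𝒞.V, ∃ Φ : (Σ f : (Σ w, 𝒞.E w u), 𝒞.VG u ⧸ (𝒞.φτ f.2).range) →
      (Σ e : (Σ w, ℬ.E w (onV u)), ℬ.VG (onV u) ⧸ (ℬ.φτ e.2).range),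
    (∀ (w : 𝒞.V) (f : 𝒞.E w u) (h : 𝒞.VG u),
      Φ ⟨⟨w, f⟩, QuotientGroup.mk h⟩ =
        ⟨⟨onV w, onE f⟩, QuotientGroup.mk (onVG u h * δτ f)⟩) ∧ Function.Bijective Φ

/-- A covering is finite(-sheeted) if the number of sheets `∑_{u ↦ v} [G_v : H_u]` over every
vertex `v` is finite. -/
def Covering.IsFinite {𝒞 ℬ : GraphOfGroups.{u}} (Φ : Covering 𝒞 ℬ) : Prop :=
  (∀ v : ℬ.V, Finite {u : 𝒞.V // Φ.onV u = v}) ∧ ∀ u : 𝒞.V, (Φ.onVG u).range.FiniteIndex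

end GraphOfGroups

/-! ### Surface groups with boundary and standard branched surfaces -/

/-- Generators of the fundamental group of a surface of genus `g` with `n` boundary components. -/
inductive SurfaceGen (g n : ℕ)
  | a (i : Fin g)
  | b (i : Fin g)
  | c (j : Fin n)

/-- The surface relator `[a₁,b₁] ⋯ [a_g,b_g] c₁ ⋯ cₙ`, where `[a,b] = a b a⁻¹ b⁻¹`. -/
def surfaceRelator (g n : ℕ) : FreeGroup (SurfaceGen g n) :=
  (List.ofFn fun i : Fin g =>
      FreeGroup.of (SurfaceGen.a (n := n) i) * FreeGroup.of (SurfaceGen.b (n := n) i) *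
        (FreeGroup.of (SurfaceGen.a (n := n) i))⁻¹ * (FreeGroup.of (SurfaceGen.b (n := n) i))⁻¹).prod *
    (List.ofFn fun j : Fin n => FreeGroup.of (SurfaceGen.c (g := g) j)).prod

/-- The fundamental group `⟨aᵢ, bᵢ, cⱼ | [a₁,b₁] ⋯ [a_g,b_g] c₁ ⋯ cₙ⟩` of the compact, connected,
oriented surface of genus `g` with `n` boundary components. -/
abbrev SurfaceGroup (g n : ℕ) : Type := PresentedGroup {surfaceRelator g n}

/-- The `j`-th boundary loop, with the orientation induced from the surface. -/
def SurfaceGroup.boundary {g n : ℕ} (j : Fin n) : SurfaceGroup g n :=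
  PresentedGroup.of (SurfaceGen.c j)

/-- The data exhibiting a graph of groups `ℬ` as a standard branched surface: three surface
vertices, two cyclic vertices `C₁, C₂`, exactly one edge between each surface vertex and each
cyclic vertex (directed towards the cyclic vertex) and no other edges. -/
structure StandardBranchedSurface (ℬ : GraphOfGroups.{u}) where
  surf : Fin 3 → ℬ.V
  cyc : Fin 2 → ℬ.V
  vertices : Function.Bijective (Sum.elim surf cyc)
  edge : ∀ i j, ℬ.E (surf i) (cyc j)
  edge_unique : ∀ i j (e : ℬ.E (surf i) (cyc j)), e = edge i j
  no_edge_surf : ∀ i i', IsEmpty (ℬ.E (surf i) (surf i'))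
  no_edge_cyc : ∀ j v, IsEmpty (ℬ.E (cyc j) v)
  /-- The cyclic vertices are oriented circles: their groups are identified with `ℤ`. -/
  circle : ∀ j, Multiplicative ℤ ≃* ℬ.VG (cyc j)
  /-- The surface vertices are oriented surfaces of positive genus with two boundary components. -/
  genus : Fin 3 → ℕ
  genus_pos : ∀ i, 1 ≤ genus i
  surface : ∀ i, ℬ.VG (surf i) ≃* SurfaceGroup (genus i) 2
  /-- The edge maps into the cyclic vertex groups are isomorphisms. -/
  φτ_bijective : ∀ i j, Function.Bijective (ℬ.φτ (edge i j))
  /-- The first boundary component of each surface is identified with `C₁`, preserving the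
  orientation ... -/
  attach_zero : ∀ i (x : ℬ.EG (edge i 0)), ℬ.φτ (edge i 0) x = circle 0 (Multiplicative.ofAdd 1) →
    IsConj (surface i (ℬ.φι (edge i 0) x)) (SurfaceGroup.boundary 0)
  /-- ... and the second one with `C₂`, reversing it, so that the fundamental class of each
  surface has boundary `C₁ - C₂`. -/
  attach_one : ∀ i (x : ℬ.EG (edge i 1)), ℬ.φτ (edge i 1) x = circle 1 (Multiplicative.ofAdd 1) →
    IsConj (surface i (ℬ.φι (edge i 1) x)) (SurfaceGroup.boundary 1)⁻¹

/-- `ℬ` is a standard branched surface. -/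
def GraphOfGroups.IsStandardBranchedSurface (ℬ : GraphOfGroups.{u}) : Prop :=
  Nonempty (StandardBranchedSurface ℬ)

/-! Let `n` be the order of `M`. Each surface has positive genus, hence an `n`-fold cyclic cover in
which the first handle generator shifts the sheets and both boundary loops lift to `n` closed loops
each. Take one such cover for every `i : Fin 3` and `m ∈ M`, and one copy of each of the two circles
for every point `p = (x, y)` of `M × M`. Both circles over `p` are glued to the surface `(i, m)`
exactly when `p` lies on the `m`-th row (`i = 0`), the `m`-th column (`i = 1`) or the broken
diagonal `x + y = m` (`i = 2`). The result is a connected cover of degree `n²`.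

In homology, the only relation contributed by the surface `(i, m)` is that the differences `[C₁ᵖ] -
[C₂ᵖ]`, summed over the points `p` of its line, vanish; all other generators are free. The torsion
of `H₁` is therefore that of the group of functions `c : M × M → ℤ` modulo the functions `F₀(x) +
F₁(y) + F₂(x + y)`. As for cocycles modulo coboundaries, this torsion is `Ext(M, ℤ) ≅ Hom(M, ℤ/n) ≅
M`: a character `f` corresponds to the carry cocycle of its integer representatives
(`characterClass_injective`, `mem_range_characterClass`).

The homology is computed inside the abelianized path group, which contains `H₁` and in which all
classes of vertex group elements lie in `H₁` (`exists_H₁_addEquiv`). The path group is mapped to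
explicit coordinates by `ofPath`, and `toPath` recovers the abelianization from them
(`toPath_ofPath`). Homomorphisms out of the cyclic covers come from actions of the surface group on
`ZMod n × A` (`homOfValues`), which replaces a presentation of the subgroup. -/

/-! ### Abelian groups -/

/-- A finitely generated abelian group whose elements of finite order form a copy of `M` is
isomorphic to `M ⊕ ℤʳ`. -/
theorem exists_addEquiv_prod_of_torsion {H M : Type*} [AddCommGroup H] [AddGroup.FG H]
    [AddCommGroup M] [Finite M] (ι : M →+ H) (hι : Function.Injective ι)
    (hrange : ∀ x : H, IsOfFinAddOrder x → x ∈ ι.range) :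
    ∃ r : ℕ, Nonempty (H ≃+ M × (Fin r → ℤ)) := by
  obtain ⟨r, κ, _, p, hp, e, ⟨f⟩⟩ := AddCommGroup.equiv_free_prod_directSum_zmod H
  have : ∀ k, NeZero (p k ^ e k) := fun k => ⟨pow_ne_zero _ (hp k).ne_zero⟩
  have hfin : Finite (DirectSum κ fun k => ZMod (p k ^ e k)) :=
    Finite.of_equiv _ (DirectSum.addEquivProd fun k => ZMod (p k ^ e k)).symm.toEquiv
  have hfst : ∀ m, (f (ι m)).1 = 0 := by
    intro m
    have h : IsOfFinAddOrder ((AddMonoidHom.fst _ _).comp (f.toAddMonoidHom.comp ι) m) :=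
      AddMonoidHom.isOfFinAddOrder _ (isOfFinAddOrder_of_finite m)
    rw [isOfFinAddOrder_iff_nsmul_eq_zero] at h
    obtain ⟨k, hk, h⟩ := h
    exact (smul_eq_zero.mp h).resolve_left hk.ne'
  let ψ : M →+ DirectSum κ fun k => ZMod (p k ^ e k) :=
    (AddMonoidHom.snd _ _).comp (f.toAddMonoidHom.comp ι)
  have hψ : Function.Bijective ψ := by
    refine ⟨fun x y hxy => hι (f.injective (Prod.ext ?_ hxy)), fun d => ?_⟩
    · rw [hfst, hfst]
    · have h : IsOfFinAddOrder (f.symm (0, d)) := by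
        have := AddMonoidHom.isOfFinAddOrder
          (f.symm.toAddMonoidHom.comp (AddMonoidHom.inr (Fin r →₀ ℤ) _))
          (isOfFinAddOrder_of_finite d)
        simpa using this
      obtain ⟨m, hm⟩ := hrange _ h
      exact ⟨m, by simp [ψ, hm]⟩
  let e₂ := (AddEquiv.ofBijective ψ hψ).symm
  let e₁ : (Fin r →₀ ℤ) ≃+ (Fin r → ℤ) :=
    (Finsupp.linearEquivFunOnFinite ℤ ℤ (Fin r)).toAddEquiv
  exact ⟨r, ⟨(f.trans (AddEquiv.prodCongr e₁ e₂)).trans AddEquiv.prodComm⟩⟩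

/-- The cyclic group `ℤ/n` plays the role of the `n`-th roots of unity, so that duality of finite
abelian groups applies to `ℤ/n`-valued characters. -/
instance Multiplicative.hasEnoughRootsOfUnity_zmod (n : ℕ) [NeZero n] :
    HasEnoughRootsOfUnity (Multiplicative (ZMod n)) n where
  prim := by
    refine ⟨Multiplicative.ofAdd 1, ?_⟩
    have h : orderOf (Multiplicative.ofAdd (1 : ZMod n)) = n := by
      rw [orderOf_ofAdd_eq_addOrderOf, ZMod.addOrderOf_one]
    have := IsPrimitiveRoot.orderOf (Multiplicative.ofAdd (1 : ZMod n))
    rwa [h] at this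
  cyc := by
    have : IsCyclic (Multiplicative (ZMod n))ˣ :=
      isCyclic_of_surjective (toUnits (G := Multiplicative (ZMod n))) toUnits.surjective
    infer_instance

/-- A finite abelian group is isomorphic to its group of `ℤ/n`-valued characters, `n` its order. -/
theorem nonempty_addEquiv_addMonoidHom_zmod (M : Type*) [AddCommGroup M] [Finite M] :
    Nonempty (M ≃+ (M →+ ZMod (Nat.card M))) := by
  have : NeZero (Nat.card M) := ⟨Nat.card_pos.ne'⟩
  have : NeZero (Monoid.exponent (Multiplicative M)) := ⟨Monoid.exponent_ne_zero_of_finite⟩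
  have hdvd : Monoid.exponent (Multiplicative M) ∣ Nat.card M :=
    Group.exponent_dvd_nat_card (G := Multiplicative M)
  have : HasEnoughRootsOfUnity (Multiplicative (ZMod (Nat.card M)))
      (Monoid.exponent (Multiplicative M)) := HasEnoughRootsOfUnity.of_dvd _ hdvd
  obtain ⟨e⟩ := CommGroup.monoidHom_mulEquiv_of_hasEnoughRootsOfUnity (Multiplicative M)
    (Multiplicative (ZMod (Nat.card M)))
  let c : (Multiplicative M →* (Multiplicative (ZMod (Nat.card M)))ˣ) ≃*
      (Multiplicative M →* Multiplicative (ZMod (Nat.card M))) :=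
    MulEquiv.monoidHomCongrRight toUnits.symm
  let d : Multiplicative (M →+ ZMod (Nat.card M)) ≃*
      (Multiplicative M →* Multiplicative (ZMod (Nat.card M))) :=
    { Multiplicative.toAdd.trans AddMonoidHom.toMultiplicative with
      map_mul' := fun _ _ => rfl }
  exact ⟨AddEquiv.toMultiplicative.symm ((e.symm.trans c).trans d.symm)⟩

/-! ### The cokernel of an incidence map -/

section Incidence

variable {ι L M : Type*} [Fintype ι]

/-- The transpose of the incidence map of "points" `L` and "lines" `ι × M`, the point `p` lying on
the lines `(i, line i p)`. -/
def incidenceMap (line : ι → L → M) : (ι → M → ℤ) →+ (L → ℤ) where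
  toFun F p := ∑ i, F i (line i p)
  map_zero' := by ext; simp
  map_add' F G := by ext; simp [Finset.sum_add_distrib]

/-- The free abelian group on the points modulo the sums of the points on each line. -/
abbrev IncidenceQuotient (line : ι → L → M) : Type _ := (L → ℤ) ⧸ (incidenceMap line).range

end Incidence

/-! ### Torsion of the Latin square quotient: `Ext(M, ℤ)` by explicit cocycles. -/

section Latin

variable {M : Type*} [AddCommGroup M]

/-- The points of the Latin square of `M` lie on rows, columns and broken diagonals. -/
def latinLine (i : Fin 3) (p : M × M) : M := ![p.1, p.2, p.1 + p.2] i

theorem incidenceMap_latinLine (F : Fin 3 → M → ℤ) (x y : M) :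
    incidenceMap latinLine F (x, y) = F 0 x + F 1 y + F 2 (x + y) := by
  simp [incidenceMap, latinLine, Fin.sum_univ_three]

variable {n : ℕ} [NeZero n]

theorem dvd_val_add_sub (x y : ZMod n) : (n : ℤ) ∣ x.val + y.val - (x + y).val := by
  rw [← ZMod.intCast_zmod_eq_zero_iff_dvd]
  simp

/-- The integral cocycle (up to coboundary) of the extension of `M` by `ℤ` given by a character. -/
def characterCocycle (f : M →+ ZMod n) (p : M × M) : ℤ :=
  ((f p.1).val + (f p.2).val - (f (p.1 + p.2)).val) / n

theorem mul_characterCocycle (f : M →+ ZMod n) (p : M × M) :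
    n * characterCocycle f p = (f p.1).val + (f p.2).val - (f (p.1 + p.2)).val := by
  rw [characterCocycle, map_add]
  exact Int.mul_ediv_cancel' (dvd_val_add_sub _ _)

/-- The class of the cocycle of a character. -/
def characterClass : (M →+ ZMod n) →+ IncidenceQuotient (latinLine (M := M)) :=
  AddMonoidHom.mk' (fun f => QuotientAddGroup.mk (characterCocycle f)) fun f g => by
    rw [← QuotientAddGroup.mk_add, QuotientAddGroup.eq]
    have h : ∀ x, (n : ℤ) ∣ (f x).val + (g x).val - ((f + g) x).val :=
      fun x => dvd_val_add_sub _ _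
    choose c hc using h
    -- Here `c x` is the carry in adding the representatives of `f x` and `g x`; the two cocycles
    -- differ by its coboundary.
    refine ⟨![c, c, -c], funext fun p => ?_⟩
    have hn : (n : ℤ) ≠ 0 := NeZero.ne _
    apply mul_left_cancel₀ hn
    rw [incidenceMap_latinLine]
    have h1 := mul_characterCocycle f p
    have h2 := mul_characterCocycle g p
    have h3 := mul_characterCocycle (f + g) p
    have h4 := hc p.1
    have h5 := hc p.2
    have h6 := hc (p.1 + p.2)
    simp only [Pi.add_apply, Pi.neg_apply, Matrix.cons_val]
    linear_combination h3 - h1 - h2 - h4 - h5 + h6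

theorem characterClass_apply (f : M →+ ZMod n) :
    characterClass f = QuotientAddGroup.mk (characterCocycle f) := rfl

theorem addMonoidHom_int_eq_zero [Finite M] (f : M →+ ℤ) : f = 0 := by
  ext x
  have h := AddMonoidHom.isOfFinAddOrder f (isOfFinAddOrder_of_finite x)
  rw [isOfFinAddOrder_iff_nsmul_eq_zero] at h
  obtain ⟨k, hk, h⟩ := h
  exact (smul_eq_zero.mp h).resolve_left hk.ne'

/-- If the carry cocycle is a coboundary, correcting the representatives of `f` by multiples of `n`
makes them additive up to a constant. A homomorphism from a finite group to `ℤ` vanishes, so `f` is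
zero mod `n`. -/
theorem characterClass_injective [Finite M] :
    Function.Injective (characterClass : (M →+ ZMod n) →+ _) := by
  rw [injective_iff_map_eq_zero]
  intro f hf
  rw [characterClass_apply, QuotientAddGroup.eq_zero_iff] at hf
  obtain ⟨F, hF⟩ := hf
  have key : ∀ x y, ((f x).val - n * F 0 x) + ((f y).val - n * F 1 y) =
      (f (x + y)).val + n * F 2 (x + y) := by
    intro x y
    have h1 := mul_characterCocycle f (x, y)
    rw [← hF, incidenceMap_latinLine] at h1
    simp only at h1
    linarith
  -- An identity `A x + B y = C (x + y)` forces `A - A 0` to be additive; here `A x = (f x).val - n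
  -- * F 0 x`.
  let h : M →+ ℤ := AddMonoidHom.mk'
    (fun x => ((f x).val - n * F 0 x) - ((f 0).val - n * F 0 0)) fun x y => by
      have h1 := key x y
      have h2 := key (x + y) 0
      have h3 := key 0 y
      have h4 := key y 0
      have h5 := key 0 0
      simp only [add_zero, zero_add] at h1 h2 h3 h4 h5
      linarith
  ext x
  have hx : h x = 0 := by rw [addMonoidHom_int_eq_zero h]; rfl
  have hx' := congrArg (Int.cast : ℤ → ZMod n) hx
  simpa [h] using hx'

/-- If `k c` is a coboundary of `F`, then mod `k` the function `F 0 - F 0 0` is a character of `M`.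
As `n` kills `M`, the quotient `d = n (F 0 - F 0 0) / k` is integral, and its reduction mod `n` is
the character whose class is that of `c`. -/
theorem mem_range_characterClass (hn : ∀ x : M, n • x = 0)
    {q : IncidenceQuotient (latinLine (M := M))} (hq : IsOfFinAddOrder q) :
    q ∈ (characterClass : (M →+ ZMod n) →+ _).range := by
  obtain ⟨c, rfl⟩ := QuotientAddGroup.mk_surjective q
  rw [isOfFinAddOrder_iff_nsmul_eq_zero] at hq
  obtain ⟨k, hk, hq⟩ := hq
  rw [← QuotientAddGroup.mk_nsmul, QuotientAddGroup.eq_zero_iff] at hq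
  obtain ⟨F, hF⟩ := hq
  have key : ∀ x y, F 0 x + F 1 y + F 2 (x + y) = k * c (x, y) := by
    intro x y
    rw [← incidenceMap_latinLine, hF]; simp
  have hk0 : (k : ℤ) ≠ 0 := by exact_mod_cast hk.ne'
  have : NeZero k := ⟨hk.ne'⟩
  have keyk : ∀ x y, ((F 0 x : ℤ) : ZMod k) + (F 1 y : ℤ) + (F 2 (x + y) : ℤ) = 0 := by
    intro x y
    have := congrArg (Int.cast : ℤ → ZMod k) (key x y)
    simpa using this
  let h : M →+ ZMod k := AddMonoidHom.mk' (fun x => ((F 0 x - F 0 0 : ℤ) : ZMod k)) fun x y => by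
    have h1 := keyk x y
    have h2 := keyk (x + y) 0
    have h3 := keyk 0 y
    have h4 := keyk y 0
    have h5 := keyk 0 0
    simp only [add_zero, zero_add] at h1 h2 h3 h4 h5
    push_cast
    linear_combination h2 - h1 + h3 - h4
  have hdvd : ∀ x, (k : ℤ) ∣ n * (F 0 x - F 0 0) := by
    intro x
    rw [← ZMod.intCast_zmod_eq_zero_iff_dvd]
    have : n • h x = 0 := by rw [← map_nsmul, hn, map_zero]
    simpa [h] using this
  choose d hd using hdvd
  -- Comparing the points `(0, y)` and `(y, 0)`, which lie on the same diagonal, shows that `F 0`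
  -- and `F 1` agree mod `k` up to a constant.
  have hF1 : ∀ y, (k : ℤ) ∣ F 1 y - F 1 0 - (F 0 y - F 0 0) := by
    intro y
    rw [show F 1 y - F 1 0 - (F 0 y - F 0 0) = k * (c (0, y) - c (y, 0)) by
      have h1 := key 0 y
      have h2 := key y 0
      simp only [zero_add, add_zero] at h1 h2
      linarith]
    exact dvd_mul_right _ _
  choose s hs using hF1
  have hF2 : ∀ z, F 2 z = k * c (z, 0) - F 0 z - F 1 0 := by
    intro z
    have := key z 0
    rw [add_zero] at this
    linarith
  -- With `F 1` and `F 2` expressed through `F 0`, the factor `k` cancels. Mod `n` this says that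
  -- `d` is additive.
  have hc : ∀ x y, c (x, y) * n = d x + d y - d (x + y) + n * (s y + c (x + y, 0)) := by
    intro x y
    apply mul_left_cancel₀ hk0
    have h1 := key x y
    have h3 := hF2 (x + y)
    have h4 := hs y
    have h5 := hd x
    have h6 := hd y
    have h7 := hd (x + y)
    linear_combination (-n) * h1 + n * h3 + h5 + h6 - h7 + n * h4
  let f : M →+ ZMod n := AddMonoidHom.mk' (fun x => ((d x : ℤ) : ZMod n)) fun x y => by
    have := congrArg (Int.cast : ℤ → ZMod n) (hc x y)
    push_cast at this
    rw [CharP.cast_eq_zero] at this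
    linear_combination this
  have hn0 : (n : ℤ) ≠ 0 := NeZero.ne _
  have hf : ∀ x, (n : ℤ) ∣ d x - (f x).val := by
    intro x
    rw [← ZMod.intCast_zmod_eq_zero_iff_dvd]
    simp [f]
  choose t ht using hf
  refine ⟨f, ?_⟩
  rw [characterClass_apply, QuotientAddGroup.eq]
  -- The coboundary of `t` replaces `d` by the representatives of `f`; the terms `s` and `c (z, 0)`
  -- are those left over in `hc`.
  refine ⟨![t, t + s, -t + (fun z => c (z, 0))], funext fun p => ?_⟩
  apply mul_left_cancel₀ hn0
  rw [incidenceMap_latinLine]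
  have h1 := mul_characterCocycle f p
  have h2 := hc p.1 p.2
  have h3 := ht p.1
  have h4 := ht p.2
  have h5 := ht (p.1 + p.2)
  simp only [Pi.add_apply, Pi.neg_apply, Matrix.cons_val]
  linear_combination h1 - h2 - h3 - h4 + h5

end Latin

/-! ### Cyclic covers of a surface with two boundary components -/

open scoped commutatorElement

namespace SurfaceGroup

/-- Names for the generators of `SurfaceGroup (g + 1) 2` other than `a₀`. -/
inductive PuncturedGen (g : ℕ)
  | a (i : Fin g)
  | b (i : Fin g)
  | b₀
  | c (j : Fin 2)

/-- The inclusion into all generators. -/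
def PuncturedGen.toGen {g : ℕ} : PuncturedGen g → SurfaceGen (g + 1) 2
  | a i => .a i.succ
  | b i => .b i.succ
  | b₀ => .b 0
  | c j => .c j

section Relator

variable {g : ℕ} {G : Type*} [Group G]

theorem lift_surfaceRelator (x : SurfaceGen (g + 1) 2 → G) :
    FreeGroup.lift x (surfaceRelator (g + 1) 2) =
      x (.a 0) * x (.b 0) * (x (.a 0))⁻¹ * (x (.b 0))⁻¹ *
        (List.ofFn fun i : Fin g => ⁅x (.a i.succ), x (.b i.succ)⁆).prod * x (.c 0) * x (.c 1) := by
  simp [surfaceRelator, map_list_prod, List.map_ofFn, Function.comp_def, List.ofFn_succ,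
    commutatorElement_def, mul_assoc]

theorem list_prod_ofFn_commutator_eq_one (x y : Fin g → G) (h : ∀ i, Commute (x i) (y i)) :
    (List.ofFn fun i => ⁅x i, y i⁆).prod = 1 := by
  apply List.prod_eq_one
  intro z hz
  obtain ⟨i, rfl⟩ := List.mem_ofFn.mp hz
  exact commutatorElement_eq_one_iff_commute.mpr (h i)

/-- The homomorphism out of the surface group with prescribed values, when all handles but the
first have commuting images. -/
def liftOfCommute (x : SurfaceGen (g + 1) 2 → G)
    (hcomm : ∀ i : Fin g, Commute (x (.a i.succ)) (x (.b i.succ)))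
    (hrel : x (.a 0) * x (.b 0) * (x (.a 0))⁻¹ * (x (.b 0))⁻¹ * x (.c 0) * x (.c 1) = 1) :
    SurfaceGroup (g + 1) 2 →* G :=
  PresentedGroup.toGroup (f := x) (by
    rintro r rfl
    rw [lift_surfaceRelator, list_prod_ofFn_commutator_eq_one _ _ hcomm, mul_one, hrel])

theorem liftOfCommute_of {x : SurfaceGen (g + 1) 2 → G}
    (hcomm : ∀ i : Fin g, Commute (x (.a i.succ)) (x (.b i.succ)))
    (hrel : x (.a 0) * x (.b 0) * (x (.a 0))⁻¹ * (x (.b 0))⁻¹ * x (.c 0) * x (.c 1) = 1)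
    (s : SurfaceGen (g + 1) 2) :
    liftOfCommute x hcomm hrel (PresentedGroup.of s) = x s :=
  PresentedGroup.toGroup.of _

end Relator

variable (g n : ℕ)

/-- The generator `a₀`. -/
def handle : SurfaceGroup (g + 1) 2 := PresentedGroup.of (.a 0)

variable {g} in
/-- The generators other than `a₀`. -/
def gen (s : PuncturedGen g) : SurfaceGroup (g + 1) 2 := PresentedGroup.of s.toGen

/-- The mod `n` character taking `a₀` to `1` and killing the other generators. -/
def handleChar : SurfaceGroup (g + 1) 2 →* Multiplicative (ZMod n) :=
  liftOfCommute
    (fun | .a i => Fin.cases (Multiplicative.ofAdd 1) (fun _ => 1) i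
         | .b _ => 1
         | .c _ => 1)
    (fun _ => Commute.all _ _) (by simp)

@[simp]
theorem handleChar_handle : handleChar g n (handle g) = Multiplicative.ofAdd 1 :=
  liftOfCommute_of _ _ _

@[simp]
theorem handleChar_gen (s : PuncturedGen g) : handleChar g n (gen s) = 1 := by
  rw [handleChar, gen, liftOfCommute_of]
  cases s <;> rfl

theorem handleChar_handle_zpow (k : ℤ) :
    handleChar g n (handle g ^ k) = Multiplicative.ofAdd (k : ZMod n) := by
  rw [map_zpow, handleChar_handle, ← ofAdd_zsmul, zsmul_one]

/-- The fundamental group of the `n`-fold cyclic cover dual to the first handle. -/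
abbrev CyclicCover : Subgroup (SurfaceGroup (g + 1) 2) := (handleChar g n).ker

namespace CyclicCover

variable {g}

/-- The `k`-th lift of a generator to the cyclic cover. -/
def lift (s : PuncturedGen g) (k : ℤ) : CyclicCover g n :=
  ⟨handle g ^ k * gen s * (handle g ^ k)⁻¹, by
    rw [MonoidHom.mem_ker]
    simp only [map_mul, map_inv, handleChar_gen, mul_one, mul_inv_cancel]⟩

variable (g) in
/-- The lift of the `n`-th power of the first handle. -/
def root : CyclicCover g n :=
  ⟨handle g ^ (n : ℤ), by
    rw [MonoidHom.mem_ker, handleChar_handle_zpow]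
    simp⟩

variable {n}

theorem lift_add_mul (s : PuncturedGen g) (k m : ℤ) :
    lift n s (k + n * m) = root g n ^ m * lift n s k * (root g n ^ m)⁻¹ := by
  ext
  simp only [lift, root, Subgroup.coe_mul, Subgroup.coe_inv, Subgroup.coe_zpow, ← zpow_mul]
  rw [add_comm k, zpow_add]
  group

/-- Changing `k` by a multiple of `n` conjugates the lift by a power of `root`, which is invisible
in a commutative group. -/
theorem map_lift_eq_of_intCast_eq {B : Type*} [CommGroup B] (φ : CyclicCover g n →* B)
    (s : PuncturedGen g) {k l : ℤ} (h : (k : ZMod n) = l) : φ (lift n s k) = φ (lift n s l) := by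
  rw [ZMod.intCast_eq_intCast_iff_dvd_sub] at h
  obtain ⟨m, hm⟩ := h
  rw [show l = k + n * m by linarith, lift_add_mul]
  simp

/-- Reidemeister–Schreier for the transversal of powers of the handle: the closure is normalised by
the handle and contains all other generators, so powers of the handle can be moved to the right. -/
theorem mem_closure_mul_handle_zpow (x : SurfaceGroup (g + 1) 2) :
    ∃ y ∈ Subgroup.closure ({handle g ^ (n : ℤ)} ∪
      {z | ∃ (s : PuncturedGen g) (k : ℤ), z = handle g ^ k * gen s * (handle g ^ k)⁻¹}),
      ∃ j : ℤ, x = y * handle g ^ j := by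
  set K := Subgroup.closure ({handle g ^ (n : ℤ)} ∪
      {z | ∃ (s : PuncturedGen g) (k : ℤ), z = handle g ^ k * gen s * (handle g ^ k)⁻¹}) with hK
  have hconj : ∀ (e : ℤ) (y), y ∈ K → handle g ^ e * y * (handle g ^ e)⁻¹ ∈ K := by
    intro e y hy
    induction hy using Subgroup.closure_induction with
    | mem z hz =>
      rcases hz with rfl | ⟨s, k, rfl⟩
      · rw [← zpow_neg, ← zpow_add, ← zpow_add, show e + n + -e = (n : ℤ) by ring]
        exact Subgroup.subset_closure (Or.inl rfl)
      · refine Subgroup.subset_closure (Or.inr ⟨s, e + k, ?_⟩)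
        rw [zpow_add]
        group
    | one => simp [K.one_mem]
    | mul y z _ _ hy hz =>
      have := K.mul_mem hy hz
      convert this using 1
      group
    | inv y _ hy =>
      have := K.inv_mem hy
      convert this using 1
      group
  have hgen : ∀ s : PuncturedGen g, gen s ∈ K :=
    fun s => Subgroup.subset_closure (Or.inr ⟨s, 0, by simp⟩)
  have hcases : ∀ s : SurfaceGen (g + 1) 2,
      PresentedGroup.of s = handle g ∨ (PresentedGroup.of s : SurfaceGroup (g + 1) 2) ∈ K := by
    rintro (i | i | j)
    · refine Fin.cases (Or.inl rfl) (fun i => Or.inr (hgen (.a i))) i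
    · exact Or.inr (Fin.cases (hgen .b₀) (fun i => hgen (.b i)) i)
    · exact Or.inr (hgen (.c j))
  have hx : x ∈ Subgroup.closure (Set.range PresentedGroup.of) := by
    rw [PresentedGroup.closure_range_of]
    trivial
  induction hx using Subgroup.closure_induction_left with
  | one => exact ⟨1, K.one_mem, 0, by simp⟩
  | mul_left z hz x _ ih =>
    obtain ⟨y, hy, j, rfl⟩ := ih
    obtain ⟨s, rfl⟩ := hz
    rcases hcases s with h | h
    · refine ⟨_, hconj 1 y hy, j + 1, ?_⟩
      rw [h, add_comm j, zpow_add]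
      group
    · exact ⟨_, K.mul_mem h hy, j, by rw [mul_assoc]⟩
  | inv_mul_cancel z hz x _ ih =>
    obtain ⟨y, hy, j, rfl⟩ := ih
    obtain ⟨s, rfl⟩ := hz
    rcases hcases s with h | h
    · refine ⟨_, hconj (-1) y hy, -1 + j, ?_⟩
      rw [h, zpow_add]
      group
    · exact ⟨_, K.mul_mem (K.inv_mem h) hy, j, by rw [mul_assoc]⟩

/-- The cyclic cover is generated by the root and the lifts of the generators. -/
theorem hom_ext {B : Type*} [Group B] {φ ψ : CyclicCover g n →* B}
    (hroot : φ (root g n) = ψ (root g n)) (hlift : ∀ s k, φ (lift n s k) = ψ (lift n s k)) :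
    φ = ψ := by
  have hle : Subgroup.closure ({handle g ^ (n : ℤ)} ∪
      {z | ∃ (s : PuncturedGen g) (k : ℤ), z = handle g ^ k * gen s * (handle g ^ k)⁻¹}) ≤
      (φ.eqLocus ψ).map (CyclicCover g n).subtype := by
    rw [Subgroup.closure_le]
    rintro z (rfl | ⟨s, k, rfl⟩)
    · exact ⟨root g n, hroot, rfl⟩
    · exact ⟨lift n s k, hlift s k, rfl⟩
  ext x
  obtain ⟨y, hy, j, hx⟩ := mem_closure_mul_handle_zpow (n := n) x.1
  obtain ⟨y, hy', rfl⟩ := hle hy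
  -- Both `x` and `y` are killed by `handleChar`, so the remaining power of the handle is a power of
  -- `root`.
  have hj : ((j : ℤ) : ZMod n) = 0 := by
    have h := x.2
    rw [MonoidHom.mem_ker, hx, map_mul, handleChar_handle_zpow] at h
    have h' : handleChar g n y.1 = 1 := y.2
    rw [Subgroup.subtype_apply, h', one_mul] at h
    exact h
  rw [ZMod.intCast_zmod_eq_zero_iff_dvd] at hj
  obtain ⟨m, rfl⟩ := hj
  have hx' : x = y * root g n ^ m := by
    ext
    rw [hx]
    simp [root, zpow_mul]
  have hy'' : φ y = ψ y := hy'
  rw [hx', map_mul, map_mul, map_zpow, map_zpow, hroot, hy'']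

/-- For homomorphisms into a commutative group it suffices to consider `n` lifts of each
generator. -/
theorem hom_ext_zmod [NeZero n] {B : Type*} [CommGroup B] {φ ψ : CyclicCover g n →* B}
    (hroot : φ (root g n) = ψ (root g n))
    (hlift : ∀ s (k : ZMod n), φ (lift n s k.val) = ψ (lift n s k.val)) : φ = ψ := by
  refine hom_ext hroot fun s k => ?_
  have h : (k : ZMod n) = (((k : ZMod n).val : ℤ) : ZMod n) := by simp
  rw [map_lift_eq_of_intCast_eq φ s h, map_lift_eq_of_intCast_eq ψ s h, hlift]

/-- The boundary of a fundamental domain of the cyclic cover. -/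
theorem map_lift_b₀_add_one {B : Type*} [CommGroup B] (φ : CyclicCover g n →* B) (k : ℤ) :
    φ (lift n .b₀ (k + 1)) * φ (lift n (.c 0) k) * φ (lift n (.c 1) k) = φ (lift n .b₀ k) := by
  have hone : FreeGroup.lift
      (fun s : SurfaceGen (g + 1) 2 => (PresentedGroup.of s : SurfaceGroup (g + 1) 2))
      (surfaceRelator (g + 1) 2) = 1 := by
    have := PresentedGroup.one_of_mem (rels := {surfaceRelator (g + 1) 2})
      (Set.mem_singleton (surfaceRelator (g + 1) 2))
    rw [← this]
    congr 1
    ext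
    simp [PresentedGroup.of]
  obtain ⟨W, hW₀⟩ : ∃ W : SurfaceGroup (g + 1) 2,
      W = (List.ofFn fun i : Fin g => ⁅gen (.a i), gen (.b i)⁆).prod := ⟨_, rfl⟩
  have hrel : handle g * gen .b₀ * (handle g)⁻¹ * (gen .b₀)⁻¹ * W * gen (.c 0) *
      gen (.c 1) = 1 := by
    rw [lift_surfaceRelator] at hone
    rw [hW₀]
    exact hone
  have hW : (((List.ofFn fun i : Fin g => ⁅lift n (.a i) k, lift n (.b i) k⁆).prod :
      CyclicCover g n) : SurfaceGroup (g + 1) 2) = handle g ^ k * W * (handle g ^ k)⁻¹ := by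
    rw [hW₀, ← MulAut.conj_apply, ← (CyclicCover g n).subtype_apply, map_list_prod,
      map_list_prod, List.map_ofFn, List.map_ofFn]
    congr 2
    ext i
    rw [Function.comp_apply, Function.comp_apply, map_commutatorElement, map_commutatorElement]
    rfl
  -- This is the surface relator conjugated by `handle g ^ k`. The handle in front of the first `b₀`
  -- raises its index by one; the commutators of the other handles die in `B`.
  have hH : lift n .b₀ (k + 1) * (lift n .b₀ k)⁻¹ *
      (List.ofFn fun i : Fin g => ⁅lift n (.a i) k, lift n (.b i) k⁆).prod *
      lift n (.c 0) k * lift n (.c 1) k = 1 := by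
    ext
    rw [Subgroup.coe_mul, Subgroup.coe_mul, Subgroup.coe_mul, hW]
    rw [← conj_eq_one_iff (a := handle g ^ k)] at hrel
    rw [Subgroup.coe_one, ← hrel]
    simp only [lift, Subgroup.coe_mul, Subgroup.coe_inv, zpow_add_one]
    group
  have h := congrArg φ hH
  simp only [map_mul, map_inv, map_one, map_list_prod, List.map_ofFn] at h
  have h1 : (List.ofFn (φ ∘ fun i : Fin g => ⁅lift n (.a i) k, lift n (.b i) k⁆)).prod = 1 := by
    simp only [Function.comp_def, map_commutatorElement]
    exact list_prod_ofFn_commutator_eq_one _ _ fun i => Commute.all _ _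
  rw [h1, mul_one, mul_assoc, mul_right_comm, mul_inv_eq_one] at h
  rw [mul_assoc]
  exact h

/-! #### Construction of homomorphisms -/

section Extension

variable {A : Type*} [AddCommGroup A]

/-- Fibrewise translation of `ZMod n × A`. -/
def fibreTranslation (f : ZMod n → A) : Equiv.Perm (ZMod n × A) where
  toFun p := (p.1, p.2 + f p.1)
  invFun p := (p.1, p.2 - f p.1)
  left_inv p := by simp
  right_inv p := by simp

/-- The shift of `ZMod n` lifted to `ZMod n × A`, with total holonomy `α`. -/
def holonomyShift (α : A) : Equiv.Perm (ZMod n × A) where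
  -- The shift is by `-1` so that conjugating by the `k`-th power of the handle brings the value at
  -- `k` to the fibre over `0`. The holonomy is picked up only on leaving `0`, hence once in `n`
  -- steps.
  toFun p := (p.1 - 1, p.2 + if p.1 = 0 then α else 0)
  invFun p := (p.1 + 1, p.2 - if p.1 + 1 = 0 then α else 0)
  left_inv p := by simp
  right_inv p := by simp

/-- Permutations of `ZMod n × A` commuting with the translations by `A` and covering the
translation by `-c`. -/
def IsEquivariantOver (c : Multiplicative (ZMod n)) (σ : Equiv.Perm (ZMod n × A)) : Prop :=
  ∀ (k : ZMod n) (x y : A), (σ (k, x)).1 = k - c.toAdd ∧ (σ (k, x + y)).2 = (σ (k, x)).2 + y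

/-- The action of a generator of the surface group on `ZMod n × A`. -/
def genPerm (α : A) (f : PuncturedGen g → ZMod n → A) :
    SurfaceGen (g + 1) 2 → Equiv.Perm (ZMod n × A)
  | .a i => Fin.cases (holonomyShift α) (fun i => fibreTranslation (f (.a i))) i
  | .b i => Fin.cases (fibreTranslation (f .b₀)) (fun i => fibreTranslation (f (.b i))) i
  | .c j => fibreTranslation (f (.c j))

theorem genPerm_toGen (α : A) (f : PuncturedGen g → ZMod n → A) (s : PuncturedGen g) :
    genPerm α f s.toGen = fibreTranslation (f s) := by
  cases s <;> rfl

theorem fibreTranslation_commute (f h : ZMod n → A) :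
    Commute (fibreTranslation f) (fibreTranslation h) := by
  ext p <;> simp [fibreTranslation, add_right_comm]

/-- The action of the surface group on `ZMod n × A`. -/
def surfacePerm (α : A) (f : PuncturedGen g → ZMod n → A)
    (hf : ∀ k, f .b₀ (k + 1) + f (.c 0) k + f (.c 1) k = f .b₀ k) :
    SurfaceGroup (g + 1) 2 →* Equiv.Perm (ZMod n × A) :=
  liftOfCommute (genPerm α f) (fun _ => fibreTranslation_commute _ _) (by
    ext ⟨k, x⟩
    · simp [genPerm, fibreTranslation, holonomyShift, Equiv.Perm.inv_def]
    -- Conjugation by the handle makes `b₀` act on the fibre over `k` by its value at `k + 1`, so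
    -- the relator acts trivially exactly by `hf`.
    · have := hf k
      simp only [genPerm, fibreTranslation, holonomyShift, Equiv.Perm.inv_def, Fin.cases_zero,
        Equiv.Perm.coe_mul, Function.comp_apply, Equiv.coe_fn_mk, Equiv.coe_fn_symm_mk,
        Equiv.Perm.coe_one, id_eq, ← this]
      abel)

variable (α : A) (f : PuncturedGen g → ZMod n → A)
    (hf : ∀ k, f .b₀ (k + 1) + f (.c 0) k + f (.c 1) k = f .b₀ k)

theorem surfacePerm_handle : surfacePerm α f hf (handle g) = holonomyShift α :=
  liftOfCommute_of _ _ _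

theorem surfacePerm_gen (s : PuncturedGen g) :
    surfacePerm α f hf (gen s) = fibreTranslation (f s) := by
  exact (liftOfCommute_of _ _ _).trans (genPerm_toGen α f s)

theorem isEquivariantOver_surfacePerm (x : SurfaceGroup (g + 1) 2) :
    IsEquivariantOver (handleChar g n x) (surfacePerm α f hf x) := by
  have hx : x ∈ Subgroup.closure (Set.range PresentedGroup.of) := by
    rw [PresentedGroup.closure_range_of]
    trivial
  have hgen : ∀ s : PuncturedGen g,
      IsEquivariantOver (handleChar g n (gen s)) (surfacePerm α f hf (gen s)) := by
    intro s k x y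
    rw [surfacePerm_gen, handleChar_gen]
    simp [fibreTranslation, add_right_comm]
  induction hx using Subgroup.closure_induction with
  | mem z hz =>
    obtain ⟨s, rfl⟩ := hz
    rcases s with i | i | j
    · refine Fin.cases ?_ (fun i => hgen (.a i)) i
      intro k x y
      have h1 := surfacePerm_handle α f hf
      have h2 := handleChar_handle g n
      rw [handle] at h1 h2
      rw [h1, h2]
      simp [holonomyShift, add_right_comm]
    · exact Fin.cases (hgen .b₀) (fun i => hgen (.b i)) i
    · exact hgen (.c j)
  | one => intro k x y; simp
  | mul y z _ _ hy hz =>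
    intro k x w
    obtain ⟨h1, h2⟩ := hz k x w
    rw [map_mul, map_mul, Equiv.Perm.mul_apply, Equiv.Perm.mul_apply,
      ← Prod.mk.eta (p := surfacePerm α f hf z (k, x + w)), h2, (hz k (x + w) 0).1,
      ← Prod.mk.eta (p := surfacePerm α f hf z (k, x)), h1]
    refine ⟨?_, (hy _ _ _).2⟩
    rw [(hy _ _ 0).1, toAdd_mul]
    ring
  | inv y _ hy =>
    intro k x w
    rw [map_inv, map_inv]
    generalize surfacePerm α f hf y = σ at *
    obtain ⟨⟨l, v⟩, hlv⟩ := σ.surjective (k, x)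
    obtain ⟨h1, h2⟩ := hy l v w
    rw [hlv] at h1 h2
    have h3 : σ (l, v + w) = (k, x + w) := Prod.ext (by rw [(hy l (v + w) 0).1, ← h1]) h2
    rw [← hlv, ← h3, Equiv.Perm.inv_def, Equiv.symm_apply_apply, Equiv.symm_apply_apply]
    refine ⟨?_, rfl⟩
    simp only at h1
    simp [h1]

/-- Elements of the cover preserve the fibre over `0` and commute with the translations by `A`, so
they act on it by a translation; its amount is the value of `homOfValues`. -/
theorem surfacePerm_apply_coe (x : CyclicCover g n) (y : A) :
    surfacePerm α f hf x (0, y) = (0, (surfacePerm α f hf x (0, 0)).2 + y) := by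
  have h := isEquivariantOver_surfacePerm α f hf x 0 0 y
  rw [zero_add] at h
  refine Prod.ext ?_ h.2
  rw [(isEquivariantOver_surfacePerm α f hf x 0 y 0).1, show handleChar g n x = 1 from x.2]
  simp

/-- The homomorphism from the fundamental group of the cyclic cover to an abelian group with
prescribed values on the root and on the lifts of the generators. -/
def homOfValues : CyclicCover g n →* Multiplicative A where
  toFun x := .ofAdd (surfacePerm α f hf x (0, 0)).2
  map_one' := by simp
  map_mul' x y := by
    rw [Subgroup.coe_mul, map_mul, Equiv.Perm.mul_apply, surfacePerm_apply_coe α f hf y,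
      surfacePerm_apply_coe α f hf x]
    simp

theorem homOfValues_lift (s : PuncturedGen g) (k : ℤ) :
    homOfValues α f hf (lift n s k) = .ofAdd (f s k) := by
  have h1 : surfacePerm α f hf (handle g ^ k)⁻¹ (0, 0) =
      ((k : ZMod n), (surfacePerm α f hf (handle g ^ k)⁻¹ (0, 0)).2) := by
    refine Prod.ext ?_ rfl
    rw [(isEquivariantOver_surfacePerm α f hf _ _ _ 0).1, map_inv, handleChar_handle_zpow]
    simp
  have h2 : surfacePerm α f hf (handle g ^ k) (surfacePerm α f hf (handle g ^ k)⁻¹ (0, 0)) =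
      (0, 0) := by
    rw [map_inv, Equiv.Perm.inv_def, Equiv.apply_symm_apply]
  change Multiplicative.ofAdd (surfacePerm α f hf
    (handle g ^ k * gen s * (handle g ^ k)⁻¹) (0, 0)).2 = _
  rw [map_mul, map_mul, Equiv.Perm.mul_apply, Equiv.Perm.mul_apply, h1, surfacePerm_gen]
  rw [h1] at h2
  have h3 := (isEquivariantOver_surfacePerm α f hf (handle g ^ k) (k : ZMod n)
    (surfacePerm α f hf (handle g ^ k)⁻¹ (0, 0)).2 (f s k)).2
  rw [h2, zero_add] at h3
  exact congrArg _ h3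

theorem holonomyShift_pow_apply (m : ℕ) (hm : m < n) (x : A) :
    (holonomyShift α ^ (m + 1)) ((0 : ZMod n), x) = (-((m + 1 : ℕ) : ZMod n), x + α) := by
  induction m with
  | zero => simp [holonomyShift]
  | succ m ih =>
    rw [pow_succ', Equiv.Perm.mul_apply, ih (by omega)]
    have h : ((m + 1 : ℕ) : ZMod n) ≠ 0 := by
      rw [Ne, ZMod.natCast_eq_zero_iff]
      exact Nat.not_dvd_of_pos_of_lt (by omega) hm
    simp only [holonomyShift, Equiv.coe_fn_mk, neg_eq_zero, h, if_false, add_zero]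
    refine Prod.ext ?_ rfl
    push_cast
    ring

theorem homOfValues_root [NeZero n] : homOfValues α f hf (root g n) = .ofAdd α := by
  change Multiplicative.ofAdd (surfacePerm α f hf (handle g ^ (n : ℤ)) (0, 0)).2 = _
  rw [zpow_natCast, map_pow, surfacePerm_handle]
  obtain ⟨m, hm⟩ := Nat.exists_eq_succ_of_ne_zero (NeZero.ne n)
  have := holonomyShift_pow_apply (n := n) α m (by omega) 0
  rw [zero_add, ← Nat.succ_eq_add_one, ← hm] at this
  rw [this]

end Extension

end CyclicCover

end SurfaceGroup

/-! ### The homology of a graph of groups -/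

namespace GraphOfGroups

section Path

variable {𝒢 : GraphOfGroups.{u}}

variable (𝒢) in
/-- The homomorphism from a vertex group to the path group. -/
def eltHom (v : 𝒢.V) : 𝒢.VG v →* 𝒢.PathGroup where
  toFun := 𝒢.elt v
  map_one' := elt_one v
  map_mul' := elt_mul v

theorem letter_mul_elt {v w : 𝒢.V} (e : 𝒢.E v w) (x : 𝒢.EG e) :
    𝒢.letter e * 𝒢.elt w (𝒢.φτ e x) = 𝒢.elt v (𝒢.φι e x) * 𝒢.letter e := by
  have := PresentedGroup.one_of_mem (rels := {r : FreeGroup 𝒢.Gen | 𝒢.Rel r}) (Rel.conj e x)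
  rw [map_mul, map_mul, map_mul, map_inv, map_inv, mul_inv_eq_one, mul_inv_eq_iff_eq_mul] at this
  exact this

/-- The homomorphism out of the path group given by compatible data. -/
def PathGroup.lift {B : Type*} [Group B] (ψ : ∀ v, 𝒢.VG v →* B)
    (t : ∀ {v w : 𝒢.V}, 𝒢.E v w → B)
    (h : ∀ (v w : 𝒢.V) (e : 𝒢.E v w) (x : 𝒢.EG e), t e * ψ w (𝒢.φτ e x) = ψ v (𝒢.φι e x) * t e) :
    𝒢.PathGroup →* B :=
  PresentedGroup.toGroup (f := fun | .elt v g => ψ v g | .edge e => t e) (by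
    rintro r (⟨v, a, b⟩ | ⟨e, x⟩)
    · simp
    · simp [h])

section Lift

variable {B : Type*} [Group B] {ψ : ∀ v, 𝒢.VG v →* B} {t : ∀ {v w : 𝒢.V}, 𝒢.E v w → B}
  (h : ∀ (v w : 𝒢.V) (e : 𝒢.E v w) (x : 𝒢.EG e), t e * ψ w (𝒢.φτ e x) = ψ v (𝒢.φι e x) * t e)

@[simp]
theorem PathGroup.lift_elt (v : 𝒢.V) (g : 𝒢.VG v) : lift ψ t h (𝒢.elt v g) = ψ v g :=
  PresentedGroup.toGroup.of _

@[simp]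
theorem PathGroup.lift_letter {v w : 𝒢.V} (e : 𝒢.E v w) : lift ψ t h (𝒢.letter e) = t e :=
  PresentedGroup.toGroup.of _

end Lift

theorem PathGroup.hom_ext {B : Type*} [Group B] {φ ψ : 𝒢.PathGroup →* B}
    (helt : ∀ v g, φ (𝒢.elt v g) = ψ (𝒢.elt v g))
    (hletter : ∀ {v w : 𝒢.V} (e : 𝒢.E v w), φ (𝒢.letter e) = ψ (𝒢.letter e)) : φ = ψ := by
  apply PresentedGroup.ext
  rintro (⟨v, g⟩ | e)
  · exact helt v g
  · exact hletter e

theorem exists_isPath (v w : 𝒢.V) : ∃ x, 𝒢.IsPath v w x := by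
  induction 𝒢.connected v w with
  | rel a b h => exact ⟨_, .letter h.some⟩
  | refl a => exact ⟨_, .elt a 1⟩
  | symm a b _ ih => obtain ⟨x, hx⟩ := ih; exact ⟨_, hx.inv⟩
  | trans a b c _ _ ih₁ ih₂ =>
    obtain ⟨x, hx⟩ := ih₁
    obtain ⟨y, hy⟩ := ih₂
    exact ⟨_, hx.mul hy⟩

/-- A chosen path between two vertices. -/
noncomputable def chosenPath (v w : 𝒢.V) : 𝒢.PathGroup := (exists_isPath v w).choose

theorem isPath_chosenPath (v w : 𝒢.V) : 𝒢.IsPath v w (chosenPath v w) :=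
  (exists_isPath v w).choose_spec

/-- The retraction of the path group onto the fundamental group obtained by joining all vertices
to the base point. -/
noncomputable def retraction (v₀ : 𝒢.V) : 𝒢.PathGroup →* 𝒢.π₁ v₀ :=
  PathGroup.lift
    (fun v =>
      { toFun := fun g => ⟨chosenPath v₀ v * 𝒢.elt v g * (chosenPath v₀ v)⁻¹,
          ((isPath_chosenPath v₀ v).mul (.elt v g)).mul (isPath_chosenPath v₀ v).inv⟩
        map_one' := by ext; simp [elt_one]
        map_mul' := fun g h => by ext; simp [elt_mul] })
    (fun {v w} e => ⟨chosenPath v₀ v * 𝒢.letter e * (chosenPath v₀ w)⁻¹,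
      ((isPath_chosenPath v₀ v).mul (.letter e)).mul (isPath_chosenPath v₀ w).inv⟩)
    (fun _ _ e x => by
      ext
      have := letter_mul_elt e x
      simp only [MonoidHom.coe_mk, OneHom.coe_mk, Subgroup.coe_mul, mul_assoc,
        inv_mul_cancel_left]
      rw [← mul_assoc (𝒢.letter e), this, mul_assoc])

theorem coe_retraction_of_isPath (v₀ : 𝒢.V) {v w : 𝒢.V} {x : 𝒢.PathGroup}
    (hx : 𝒢.IsPath v w x) :
    (retraction v₀ x : 𝒢.PathGroup) = chosenPath v₀ v * x * (chosenPath v₀ w)⁻¹ := by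
  induction hx with
  | elt v g => exact congrArg Subtype.val (PathGroup.lift_elt _ v g)
  | letter e => exact congrArg Subtype.val (PathGroup.lift_letter _ e)
  | letter_inv e =>
    rw [map_inv, retraction, PathGroup.lift_letter, Subgroup.coe_inv]
    group
  | mul _ _ hx hy =>
    rw [map_mul, Subgroup.coe_mul, hx, hy]
    group

/-- On closed paths at `v₀` the retraction is conjugation by the chosen path from `v₀` to itself, an
element of `π₁`. Hence `H₁` is a retract of the abelianized path group. -/
theorem of_retraction_coe (v₀ : 𝒢.V) (x : 𝒢.π₁ v₀) :
    Abelianization.of (retraction v₀ (x : 𝒢.PathGroup)) = Abelianization.of x := by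
  let p : 𝒢.π₁ v₀ := ⟨chosenPath v₀ v₀, isPath_chosenPath v₀ v₀⟩
  have h : retraction v₀ (x : 𝒢.PathGroup) = p * x * p⁻¹ := by
    ext
    exact coe_retraction_of_isPath v₀ x.2
  rw [h, map_mul, map_mul, map_inv, mul_right_comm, mul_inv_cancel, one_mul]

theorem of_coe_retraction_elt (v₀ v : 𝒢.V) (g : 𝒢.VG v) :
    Abelianization.of (retraction v₀ (𝒢.elt v g) : 𝒢.PathGroup) =
      Abelianization.of (𝒢.elt v g) := by
  rw [coe_retraction_of_isPath v₀ (.elt v g), map_mul, map_mul, map_inv, mul_right_comm,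
    mul_inv_cancel, one_mul]

/-- The first homology does not depend on the base point. -/
theorem nonempty_H₁_addEquiv (v w : 𝒢.V) : Nonempty (𝒢.H₁ v ≃+ 𝒢.H₁ w) := by
  have hp := isPath_chosenPath v w
  let e : 𝒢.π₁ v ≃* 𝒢.π₁ w :=
    { toFun := fun x => ⟨(chosenPath v w)⁻¹ * x * chosenPath v w, (hp.inv.mul x.2).mul hp⟩
      invFun := fun x => ⟨chosenPath v w * x * (chosenPath v w)⁻¹, (hp.mul x.2).mul hp.inv⟩
      left_inv := fun x => by ext; simp [mul_assoc]
      right_inv := fun x => by ext; simp [mul_assoc]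
      map_mul' := fun x y => by ext; simp [mul_assoc] }
  exact ⟨e.abelianizationCongr.toAdditive⟩

/-- If the abelianized path group embeds into `Q ⊕ F` with `F` torsion-free, and if `Q` is the
image of a subgroup generated by elements of the vertex groups, then the torsion of the first
homology is that of `Q`. -/
theorem exists_H₁_addEquiv {Q F M : Type*} [AddCommGroup Q] [AddCommGroup F] [AddCommGroup M]
    [Finite M] [Module.Finite ℤ Q] [Module.Finite ℤ F] [IsAddTorsionFree F]
    (μ : 𝒢.PathGroup →* Multiplicative (Q × F))
    (hμ : ∀ x, μ x = 1 → Abelianization.of x = 1)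
    (hQ : ∀ q, ∃ y ∈ Subgroup.closure {z | ∃ v g, z = 𝒢.elt v g}, μ y = .ofAdd (q, 0))
    (ι : M →+ Q) (hι : Function.Injective ι)
    (hrange : ∀ q : Q, IsOfFinAddOrder q → q ∈ ι.range) (v₀ : 𝒢.V) :
    ∃ r : ℕ, Nonempty (𝒢.H₁ v₀ ≃+ M × (Fin r → ℤ)) := by
  let j : 𝒢.H₁ v₀ →+ Q × F :=
    MonoidHom.toAdditiveLeft (Abelianization.lift (μ.comp (𝒢.π₁ v₀).subtype))
  have hj : ∀ x : 𝒢.π₁ v₀, j (.ofMul (Abelianization.of x)) = (μ x).toAdd := fun x => by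
    simp [j]
  have hjinj : Function.Injective j := by
    rw [injective_iff_map_eq_zero]
    intro a ha
    obtain ⟨x, hx⟩ := QuotientGroup.mk_surjective (Additive.toMul a)
    have hx' : a = .ofMul (Abelianization.of x) := congrArg Additive.ofMul hx.symm
    rw [hx', hj] at ha
    have h1 := hμ x (Multiplicative.toAdd.injective ha)
    -- The retraction carries vanishing in the abelianized path group back to `H₁`.
    have h2 := congrArg (Abelianization.map (retraction v₀)) h1
    rw [Abelianization.map_of, of_retraction_coe, map_one] at h2
    rw [hx', h2, ofMul_one]
  have hsurj : ∀ q : Q, ∃ a, j a = (q, 0) := by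
    intro q
    obtain ⟨y, hy, hyq⟩ := hQ q
    -- Vertex elements are closed paths, so joining them to `v₀` only conjugates them; stable
    -- letters would not be fixed in this way.
    have hfix : Abelianization.of (retraction v₀ y : 𝒢.PathGroup) = Abelianization.of y := by
      clear hyq
      induction hy using Subgroup.closure_induction with
      | mem z hz => obtain ⟨v, g, rfl⟩ := hz; exact of_coe_retraction_elt v₀ v g
      | one => simp
      | mul x y _ _ hx hy => simp [hx, hy]
      | inv x _ hx => simp [hx]
    have hμy : μ (retraction v₀ y : 𝒢.PathGroup) = μ y := by
      simpa using congrArg (Abelianization.lift μ) hfix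
    exact ⟨.ofMul (Abelianization.of (retraction v₀ y)), by rw [hj, hμy, hyq]; rfl⟩
  have : Module.Finite ℤ (𝒢.H₁ v₀) :=
    Module.Finite.of_injective j.toIntLinearMap hjinj
  have : AddGroup.FG (𝒢.H₁ v₀) := Module.Finite.iff_addGroup_fg.mp this
  choose s hs using hsurj
  let s' : Q →+ 𝒢.H₁ v₀ := AddMonoidHom.mk' s fun a b => hjinj (by simp [hs])
  refine exists_addEquiv_prod_of_torsion (s'.comp ι) ?_ ?_
  · intro a b hab
    apply hι
    have := congrArg j hab
    simpa [s', hs] using this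
  · intro x hx
    have h : IsOfFinAddOrder (j x) := AddMonoidHom.isOfFinAddOrder j hx
    have h₁ : IsOfFinAddOrder (j x).1 := AddMonoidHom.isOfFinAddOrder (.fst Q F) h
    have h₂ : (j x).2 = 0 := by
      have := AddMonoidHom.isOfFinAddOrder (.snd Q F) h
      rwa [isOfFinAddOrder_iff_eq_zero] at this
    obtain ⟨m, hm⟩ := hrange _ h₁
    refine ⟨m, hjinj ?_⟩
    change j (s (ι m)) = j x
    rw [hs, hm, ← h₂]

end Path

end GraphOfGroups

/-! ### Covers assembled from cyclic covers of the surfaces -/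

namespace SurfaceGroup

variable (g : ℕ)

/-- The two boundary loops, oriented so that the boundary of the surface is their difference. -/
def orientedBoundary (j : Fin 2) : SurfaceGroup (g + 1) 2 := ![boundary 0, (boundary 1)⁻¹] j

/-- The character taking the value `1` on both oriented boundary loops. -/
def boundaryChar : SurfaceGroup (g + 1) 2 →* Multiplicative ℤ :=
  liftOfCommute
    (fun | .a _ => 1
         | .b _ => 1
         | .c j => .ofAdd (![1, -1] j))
    (fun _ => Commute.all _ _) (by simp)

theorem boundaryChar_orientedBoundary (j : Fin 2) :
    boundaryChar g (orientedBoundary g j) = .ofAdd 1 := by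
  fin_cases j
  · exact liftOfCommute_of _ _ _
  · refine (map_inv _ _).trans ?_
    rw [inv_eq_iff_eq_inv]
    exact liftOfCommute_of _ _ _

theorem handleChar_orientedBoundary (n : ℕ) (j : Fin 2) :
    handleChar g n (orientedBoundary g j) = 1 := by
  fin_cases j
  · exact handleChar_gen g n (.c 0)
  · refine (map_inv _ _).trans ?_
    rw [inv_eq_one]
    exact handleChar_gen g n (.c 1)

variable {g}

/-- The lifts of the oriented boundary loops to the cyclic cover. -/
def CyclicCover.boundaryLift (n : ℕ) (j : Fin 2) (k : ℤ) : CyclicCover g n :=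
  ![lift n (.c 0) k, (lift n (.c 1) k)⁻¹] j

theorem CyclicCover.coe_boundaryLift (n : ℕ) (j : Fin 2) (k : ℤ) :
    ((boundaryLift n j k : CyclicCover g n) : SurfaceGroup (g + 1) 2) =
      handle g ^ k * orientedBoundary g j * (handle g ^ k)⁻¹ := by
  fin_cases j
  · rfl
  · change (handle g ^ k * gen (.c 1) * (handle g ^ k)⁻¹)⁻¹ =
      handle g ^ k * (gen (.c 1))⁻¹ * (handle g ^ k)⁻¹
    group

/-- The boundary loops have infinite order because `boundaryChar` sends them to `1`; this makes the
attaching maps of the cover injective. -/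
theorem CyclicCover.boundaryLift_zpow_injective (n : ℕ) (j : Fin 2) (k : ℤ) :
    Function.Injective (zpowersHom (CyclicCover g n) (boundaryLift n j k)) := by
  intro x y h
  have h' := congrArg (fun z : CyclicCover g n => boundaryChar g z) h
  simp only [zpowersHom_apply, Subgroup.coe_zpow, map_zpow, coe_boundaryLift, map_mul, map_inv,
    boundaryChar_orientedBoundary, mul_inv_cancel_comm] at h'
  rw [← ofAdd_zsmul, ← ofAdd_zsmul] at h'
  simpa using h'

end SurfaceGroup

/-- If edge maps `HF f → H` agree with edge maps `GE (π f) → G` up to conjugation and the edge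
groups are isomorphic, the map of cosets is bijective as soon as the elements `δ f` represent
every double coset once. -/
theorem exists_bijective_sigma_quotient {F E H G : Type*} [Group H] [Group G]
    {HF : F → Type*} [∀ f, Group (HF f)] {GE : E → Type*} [∀ e, Group (GE e)]
    {φF : ∀ f, HF f →* H} {φE : ∀ e, GE e →* G} (π : F → E) (θ : H →* G)
    (hθ : Function.Injective θ) (η : ∀ f, HF f →* GE (π f))
    (hη : ∀ f, Function.Surjective (η f)) (δ : F → G)
    (hcomm : ∀ f x, θ (φF f x) = δ f * φE (π f) (η f x) * (δ f)⁻¹)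
    (hinj : ∀ f f' h, π f = π f' → (δ f)⁻¹ * θ h * δ f' ∈ (φE (π f)).range → f = f')
    (hsurj : ∀ e g, ∃ f h, π f = e ∧ (θ h * δ f)⁻¹ * g ∈ (φE e).range) :
    ∃ Φ : (Σ f, H ⧸ (φF f).range) → (Σ e, G ⧸ (φE e).range),
      (∀ f (h : H), Φ ⟨f, QuotientGroup.mk h⟩ = ⟨π f, QuotientGroup.mk (θ h * δ f)⟩) ∧
        Function.Bijective Φ := by
  let Φ : (Σ f, H ⧸ (φF f).range) → (Σ e, G ⧸ (φE e).range) := fun x =>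
    ⟨π x.1, Quotient.liftOn' x.2 (fun h => QuotientGroup.mk (θ h * δ x.1)) (by
      intro a b hab
      rw [QuotientGroup.leftRel_apply] at hab
      obtain ⟨y, hy⟩ := hab
      rw [QuotientGroup.eq]
      refine ⟨η x.1 y, ?_⟩
      have h2 : φE (π x.1) (η x.1 y) = (δ x.1)⁻¹ * ((θ a)⁻¹ * θ b) * δ x.1 := by
        have := hcomm x.1 y
        rw [hy, map_mul, map_inv] at this
        rw [this]
        group
      rw [h2]
      group)⟩
  have hΦ : ∀ f (h : H), Φ ⟨f, QuotientGroup.mk h⟩ = ⟨π f, QuotientGroup.mk (θ h * δ f)⟩ :=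
    fun _ _ => rfl
  refine ⟨Φ, hΦ, ?_, ?_⟩
  · rintro ⟨f, x⟩ ⟨f', x'⟩ h
    obtain ⟨a, rfl⟩ := QuotientGroup.mk_surjective x
    obtain ⟨b, rfl⟩ := QuotientGroup.mk_surjective x'
    rw [hΦ, hΦ] at h
    have hπ : π f = π f' := congrArg Sigma.fst h
    have key : (δ f)⁻¹ * θ (a⁻¹ * b) * δ f' ∈ (φE (π f)).range := by
      have aux : ∀ (e e' : E) (y y' : G), (⟨e, QuotientGroup.mk y⟩ : Σ e, G ⧸ (φE e).range) =
          ⟨e', QuotientGroup.mk y'⟩ → y⁻¹ * y' ∈ (φE e).range := by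
        intro e e' y y' hyy
        obtain rfl : e = e' := congrArg Sigma.fst hyy
        rw [← QuotientGroup.eq]
        exact eq_of_heq (Sigma.mk.inj hyy).2
      have := aux _ _ _ _ h
      convert this using 1
      rw [map_mul, map_inv]
      group
    obtain rfl := hinj f f' _ hπ key
    obtain ⟨y, hy⟩ := key
    obtain ⟨z, rfl⟩ := hη f y
    refine congrArg (Sigma.mk f) (QuotientGroup.eq.mpr ⟨z, hθ ?_⟩)
    rw [hcomm, hy]
    group
  · rintro ⟨e, x⟩
    obtain ⟨y, rfl⟩ := QuotientGroup.mk_surjective x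
    obtain ⟨f, h, rfl, hy⟩ := hsurj e y
    exact ⟨⟨f, QuotientGroup.mk h⟩, by rw [hΦ, QuotientGroup.eq.mpr hy]⟩

open SurfaceGroup

section Cover

variable {M L : Type} {n : ℕ}

/-- The vertices of the cover: copies of the three surfaces indexed by `M`, and copies of the two
circles indexed by `L`. -/
inductive CoverVertex (M L : Type) : Type u
  | surf (i : Fin 3) (m : M)
  | cyc (j : Fin 2) (p : L)

/-- The edges of the cover: `inc i p` says on which copy of the `i`-th surface, and at which
position, the circles indexed by `p` lie. -/
inductive CoverEdge (inc : Fin 3 → L ≃ M × ZMod n) :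
    CoverVertex.{u} M L → CoverVertex.{u} M L → Type u
  | mk (i : Fin 3) (j : Fin 2) (p : L) (m : M) (h : (inc i p).1 = m) :
      CoverEdge inc (.surf i m) (.cyc j p)

/-- The vertex groups of the cover. -/
def CoverVertex.Grp (g : Fin 3 → ℕ) (n : ℕ) : CoverVertex.{u} M L → Type u
  | .surf i _ => ULift.{u} (CyclicCover (g i) n)
  | .cyc _ _ => ULift.{u} (Multiplicative ℤ)

instance (g : Fin 3 → ℕ) (n : ℕ) : ∀ v : CoverVertex.{u} M L, Group (v.Grp g n)
  | .surf i _ => inferInstanceAs (Group (ULift.{u} (CyclicCover (g i) n)))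
  | .cyc _ _ => inferInstanceAs (Group (ULift.{u} (Multiplicative ℤ)))

/-- The attaching map of a boundary component. -/
def CoverEdge.attach (g : Fin 3 → ℕ) {inc : Fin 3 → L ≃ M × ZMod n} :
    ∀ {v w : CoverVertex.{u} M L}, CoverEdge inc v w → ULift.{u} (Multiplicative ℤ) →* v.Grp g n
  | _, _, .mk i j p _ _ => MulEquiv.ulift.symm.toMonoidHom.comp
      ((zpowersHom (CyclicCover (g i) n) (CyclicCover.boundaryLift n j (inc i p).2.val)).comp
        MulEquiv.ulift.toMonoidHom)

/-- The identification of a boundary component with a circle. -/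
def CoverEdge.toCircle (g : Fin 3 → ℕ) {inc : Fin 3 → L ≃ M × ZMod n} :
    ∀ {v w : CoverVertex.{u} M L}, CoverEdge inc v w → ULift.{u} (Multiplicative ℤ) →* w.Grp g n
  | _, _, .mk _ _ _ _ _ => MonoidHom.id (ULift.{u} (Multiplicative ℤ))

/-- The graph of groups assembled from cyclic covers of the surfaces. -/
def cyclicCoverGraph (g : Fin 3 → ℕ) (inc : Fin 3 → L ≃ M × ZMod n) [Nonempty M]
    (hconn : ∀ v w : CoverVertex.{u} M L,
      Relation.EqvGen (fun a b => Nonempty (CoverEdge inc a b)) v w) : GraphOfGroups.{u} where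
  V := CoverVertex.{u} M L
  E := CoverEdge inc
  nonempty := ⟨.surf 0 (Classical.arbitrary M)⟩
  connected := hconn
  VG := CoverVertex.Grp g n
  EG _ := ULift.{u} (Multiplicative ℤ)
  φι := CoverEdge.attach g
  φτ := CoverEdge.toCircle g
  φι_injective := by
    rintro _ _ ⟨i, j, p, m, h⟩
    exact MulEquiv.ulift.symm.injective.comp
      ((CyclicCover.boundaryLift_zpow_injective n j _).comp MulEquiv.ulift.injective)
  φτ_injective := by
    rintro _ _ ⟨i, j, p, m, h⟩
    exact Function.injective_id

variable (g : Fin 3 → ℕ) (inc : Fin 3 → L ≃ M × ZMod n)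

/-- A normal form of the identifications in a standard branched surface. -/
structure StandardBranchedSurface.Marking {ℬ : GraphOfGroups.{u}} (S : StandardBranchedSurface ℬ)
    (g : Fin 3 → ℕ) where
  σ : ∀ i, ℬ.VG (S.surf i) ≃* SurfaceGroup (g i + 1) 2
  ε : ∀ i j, Multiplicative ℤ ≃* ℬ.EG (S.edge i j)
  /-- the conjugating elements of the attaching maps -/
  w : ∀ i, Fin 2 → SurfaceGroup (g i + 1) 2
  φτ_ε : ∀ i j z, ℬ.φτ (S.edge i j) (ε i j z) = S.circle j z
  φι_ε : ∀ i j z, σ i (ℬ.φι (S.edge i j) (ε i j z)) =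
    (w i j)⁻¹ * orientedBoundary (g i) j ^ z.toAdd * w i j

theorem StandardBranchedSurface.exists_marking {ℬ : GraphOfGroups.{u}}
    (S : StandardBranchedSurface ℬ) : ∃ g, Nonempty (S.Marking g) := by
  have hg : ∃ g : Fin 3 → ℕ, ∀ i, S.genus i = g i + 1 :=
    ⟨fun i => S.genus i - 1, fun i => (Nat.sub_add_cancel (S.genus_pos i)).symm⟩
  obtain ⟨g, hg⟩ := hg
  let ε : ∀ i j, Multiplicative ℤ ≃* ℬ.EG (S.edge i j) := fun i j =>
    (S.circle j).trans (MulEquiv.ofBijective _ (S.φτ_bijective i j)).symm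
  have hε : ∀ i j z, ℬ.φτ (S.edge i j) (ε i j z) = S.circle j z := fun i j z =>
    (MulEquiv.ofBijective _ (S.φτ_bijective i j)).apply_symm_apply (S.circle j z)
  have hσ : ∀ i, ∃ σ : ℬ.VG (S.surf i) ≃* SurfaceGroup (g i + 1) 2, ∀ j,
      IsConj (σ (ℬ.φι (S.edge i j) (ε i j (.ofAdd 1)))) (orientedBoundary (g i) j) := by
    intro i
    have h0 := S.attach_zero i (ε i 0 (.ofAdd 1)) (hε _ _ _)
    have h1 := S.attach_one i (ε i 1 (.ofAdd 1)) (hε _ _ _)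
    -- The type of the isomorphism depends on `S.genus i`, so it is generalised before the genus is
    -- rewritten as `g i + 1`.
    generalize S.surface i = σ at h0 h1
    revert σ
    rw [hg i]
    intro σ h0 h1
    refine ⟨σ, fun j => ?_⟩
    fin_cases j
    · exact h0
    · exact h1
  choose σ hσ using hσ
  simp only [isConj_iff] at hσ
  choose w hw using hσ
  refine ⟨g, ⟨⟨σ, ε, w, hε, fun i j z => ?_⟩⟩⟩
  have hz : z = Multiplicative.ofAdd (1 : ℤ) ^ z.toAdd := by
    rw [← ofAdd_zsmul]
    simp
  have hc : σ i (ℬ.φι (S.edge i j) (ε i j (.ofAdd 1))) =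
      (w i j)⁻¹ * orientedBoundary (g i) j * w i j := by
    rw [← hw]
    group
  have hcz := conj_zpow (i := z.toAdd) (a := (w i j)⁻¹) (b := orientedBoundary (g i) j)
  rw [inv_inv] at hcz
  conv_lhs => rw [hz]
  rw [map_zpow, map_zpow, map_zpow, hc, hcz]

/-! ### The covering map onto the branched surface. -/

namespace StandardBranchedSurface.Marking

open GraphOfGroups

variable {ℬ : GraphOfGroups.{u}} {S : StandardBranchedSurface ℬ} {g} (K : S.Marking g)

variable (S) in
/-- The projection of the cover on vertices. -/
def onV : CoverVertex.{u} M L → ℬ.V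
  | .surf i _ => S.surf i
  | .cyc j _ => S.cyc j

variable (S) in
/-- The projection of the cover on edges. -/
def onE {inc : Fin 3 → L ≃ M × ZMod n} :
    ∀ {v w : CoverVertex.{u} M L}, CoverEdge inc v w → ℬ.E (onV S v) (onV S w)
  | _, _, .mk i j _ _ _ => S.edge i j

/-- The projection of the cover on vertex groups. -/
def onVG (n : ℕ) : ∀ v : CoverVertex.{u} M L, v.Grp g n →* ℬ.VG (onV S v)
  | .surf i _ => (K.σ i).symm.toMonoidHom.comp
      ((CyclicCover (g i) n).subtype.comp MulEquiv.ulift.toMonoidHom)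
  | .cyc j _ => (S.circle j).toMonoidHom.comp MulEquiv.ulift.toMonoidHom

/-- The projection of the cover on edge groups. -/
def onEG {inc : Fin 3 → L ≃ M × ZMod n} : ∀ {v w : CoverVertex.{u} M L} (e : CoverEdge inc v w),
    ULift.{u} (Multiplicative ℤ) →* ℬ.EG (onE S e)
  | _, _, .mk i j _ _ _ => (K.ε i j).toMonoidHom.comp MulEquiv.ulift.toMonoidHom

/-- The elements conjugating the attaching maps to the lifts of the boundary loops. -/
def conjugator (i : Fin 3) (j : Fin 2) (k : ZMod n) : ℬ.VG (S.surf i) :=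
  (K.σ i).symm (handle (g i) ^ (k.val : ℤ) * K.w i j)

/-- The conjugating elements of the covering. -/
def δι {inc : Fin 3 → L ≃ M × ZMod n} : ∀ {v w : CoverVertex.{u} M L}, CoverEdge inc v w →
    ℬ.VG (onV S v)
  | _, _, .mk i j p _ _ => K.conjugator i j (inc i p).2

theorem onVG_injective (v : CoverVertex.{u} M L) : Function.Injective (K.onVG n v) := by
  rcases v with ⟨i, m⟩ | ⟨j, p⟩
  · exact (K.σ i).symm.injective.comp (Subtype.val_injective.comp MulEquiv.ulift.injective)
  · exact (S.circle j).injective.comp MulEquiv.ulift.injective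

theorem onEG_bijective {v w : CoverVertex.{u} M L} (e : CoverEdge inc v w) :
    Function.Bijective (K.onEG e) := by
  rcases e with ⟨i, j, p, m, h⟩
  exact (K.ε i j).bijective.comp MulEquiv.ulift.bijective

theorem comm_ι {v w : CoverVertex.{u} M L} (e : CoverEdge inc v w)
    (x : ULift.{u} (Multiplicative ℤ)) :
    K.onVG n v (e.attach g x) = K.δι e * ℬ.φι (onE S e) (K.onEG e x) * (K.δι e)⁻¹ := by
  rcases e with ⟨i, j, p, m, h⟩
  apply (K.σ i).injective
  change (K.σ i) ((K.σ i).symm _) =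
    K.σ i ((K.σ i).symm _ * ℬ.φι (S.edge i j) (K.ε i j x.down) * ((K.σ i).symm _)⁻¹)
  rw [map_mul, map_mul, map_inv, MulEquiv.apply_symm_apply, MulEquiv.apply_symm_apply, K.φι_ε]
  change ((CyclicCover.boundaryLift n j ((inc i p).2.val : ℤ) ^ x.down.toAdd :
    CyclicCover (g i) n) : SurfaceGroup (g i + 1) 2) = _
  rw [Subgroup.coe_zpow, CyclicCover.coe_boundaryLift, conj_zpow]
  group

theorem comm_τ {v w : CoverVertex.{u} M L} (e : CoverEdge inc v w)
    (x : ULift.{u} (Multiplicative ℤ)) :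
    K.onVG n w (e.toCircle g x) = 1 * ℬ.φτ (onE S e) (K.onEG e x) * 1⁻¹ := by
  rcases e with ⟨i, j, p, m, h⟩
  rw [one_mul, inv_one, mul_one]
  exact (K.φτ_ε i j x.down).symm

theorem handleChar_φι (n : ℕ) (i : Fin 3) (j : Fin 2) (x : ℬ.EG (S.edge i j)) :
    handleChar (g i) n (K.σ i (ℬ.φι (S.edge i j) x)) = 1 := by
  obtain ⟨z, rfl⟩ := (K.ε i j).surjective x
  rw [K.φι_ε, map_mul, map_mul, map_inv, map_zpow, handleChar_orientedBoundary]
  simp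

theorem handleChar_conjugator [NeZero n] (i : Fin 3) (j : Fin 2) (k : ZMod n) :
    handleChar (g i) n (K.σ i (K.conjugator i j k)) =
      .ofAdd k * handleChar (g i) n (K.w i j) := by
  rw [conjugator, MulEquiv.apply_symm_apply, map_mul, handleChar_handle_zpow]
  simp

/-- The cyclic cover is the kernel of `handleChar`, which also kills the boundary loops. Double
cosets of the two subgroups are thus classified by `ZMod n`, and the conjugators at distinct
positions represent distinct ones. -/
theorem eq_of_conjugator [NeZero n] {i : Fin 3} {j : Fin 2} {k k' : ZMod n}
    (h : CyclicCover (g i) n) (x : ℬ.EG (S.edge i j))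
    (hx : ℬ.φι (S.edge i j) x =
      (K.conjugator i j k)⁻¹ * (K.σ i).symm h * K.conjugator i j k') : k = k' := by
  have h1 := congrArg (fun y => handleChar (g i) n (K.σ i y)) hx
  simp only [map_mul, map_inv] at h1
  rw [K.handleChar_φι, MulEquiv.apply_symm_apply, K.handleChar_conjugator,
    K.handleChar_conjugator, show handleChar (g i) n h = 1 from h.2, mul_one, eq_comm,
    inv_mul_eq_one, mul_left_inj] at h1
  exact Multiplicative.ofAdd.injective h1

theorem exists_mul_conjugator [NeZero n] (i : Fin 3) (j : Fin 2) (y : ℬ.VG (S.surf i)) :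
    ∃ (k : ZMod n) (h : CyclicCover (g i) n), (K.σ i).symm h * K.conjugator i j k = y := by
  obtain ⟨k, hk⟩ : ∃ k : ZMod n, k = (handleChar (g i) n (K.σ i y)).toAdd -
      (handleChar (g i) n (K.w i j)).toAdd := ⟨_, rfl⟩
  refine ⟨k, ⟨K.σ i (y * (K.conjugator i j k)⁻¹), ?_⟩, ?_⟩
  · rw [MonoidHom.mem_ker, map_mul, map_mul, map_inv, map_inv, K.handleChar_conjugator,
      mul_inv_eq_one]
    apply Multiplicative.toAdd.injective
    simp [hk]
  · rw [MulEquiv.symm_apply_apply, inv_mul_cancel_right]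

/-- For fixed `i`, `m` and `j`, the bijection `inc i` provides exactly one circle at each position
`k : ZMod n`, and positions correspond to the elevations of the boundary loop. -/
theorem bijective_ι [NeZero n] (u : CoverVertex.{u} M L) :
    ∃ Φ : (Σ f : (Σ w, CoverEdge inc u w), u.Grp g n ⧸ (f.2.attach g).range) →
      (Σ e : (Σ w, ℬ.E (onV S u) w), ℬ.VG (onV S u) ⧸ (ℬ.φι e.2).range),
    (∀ (f : Σ w, CoverEdge inc u w) (h : u.Grp g n),
      Φ ⟨f, QuotientGroup.mk h⟩ =
        ⟨⟨onV S f.1, onE S f.2⟩, QuotientGroup.mk (K.onVG n u h * K.δι f.2)⟩) ∧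
      Function.Bijective Φ := by
  refine exists_bijective_sigma_quotient (F := Σ w, CoverEdge inc u w) (E := Σ w, ℬ.E (onV S u) w)
    (H := u.Grp g n) (G := ℬ.VG (onV S u)) (HF := fun _ => ULift.{u} (Multiplicative ℤ))
    (GE := fun e => ℬ.EG e.2) (φF := fun f => f.2.attach g) (φE := fun e => ℬ.φι e.2)
    (fun f => ⟨onV S f.1, onE S f.2⟩) (K.onVG n u) (K.onVG_injective u)
    (fun f => K.onEG f.2) (fun f => (K.onEG_bijective inc f.2).2) (fun f => K.δι f.2)
    (fun f x => K.comm_ι inc f.2 x) ?_ ?_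
  · rintro ⟨_, ⟨i, j, p, m, hm⟩⟩ ⟨_, ⟨_, j', p', _, hm'⟩⟩ h hπ ⟨x, hx⟩
    have hj : Sum.inr j = (Sum.inr j' : Fin 3 ⊕ Fin 2) :=
      S.vertices.1 (congrArg Sigma.fst hπ)
    obtain rfl : j = j' := Sum.inr_injective hj
    have hk : (inc i p).2 = (inc i p').2 := K.eq_of_conjugator h.down x hx
    have hp : p = p' := (inc i).injective (Prod.ext (hm.trans hm'.symm) hk)
    subst hp
    rfl
  · rintro ⟨w, e⟩ y
    obtain ⟨w, rfl⟩ := S.vertices.2 w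
    rcases u with ⟨i, m⟩ | ⟨j, p⟩
    · rcases w with i' | j
      · exact ((S.no_edge_surf i i').false e).elim
      · obtain rfl : e = S.edge i j := S.edge_unique i j e
        obtain ⟨k, h, hy⟩ := K.exists_mul_conjugator (n := n) i j y
        obtain ⟨p, hp⟩ := (inc i).surjective (m, k)
        refine ⟨⟨_, .mk i j p m (by rw [hp])⟩, ULift.up h, rfl, 1, ?_⟩
        rw [map_one, eq_comm, inv_mul_eq_one]
        change (K.σ i).symm h * K.conjugator i j (inc i p).2 = y
        rw [hp, hy]
    · exact ((S.no_edge_cyc j _).false e).elim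

/-- Every circle of the cover maps isomorphically to its image and meets one copy of each surface,
so all coset spaces are points and edges correspond to edges. -/
theorem bijective_τ (u : CoverVertex.{u} M L) :
    ∃ Φ : (Σ f : (Σ w, CoverEdge inc w u), u.Grp g n ⧸ (f.2.toCircle g).range) →
      (Σ e : (Σ w, ℬ.E w (onV S u)), ℬ.VG (onV S u) ⧸ (ℬ.φτ e.2).range),
    (∀ (f : Σ w, CoverEdge inc w u) (h : u.Grp g n),
      Φ ⟨f, QuotientGroup.mk h⟩ =
        ⟨⟨onV S f.1, onE S f.2⟩, QuotientGroup.mk (K.onVG n u h * 1)⟩) ∧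
      Function.Bijective Φ := by
  refine exists_bijective_sigma_quotient (F := Σ w, CoverEdge inc w u) (E := Σ w, ℬ.E w (onV S u))
    (H := u.Grp g n) (G := ℬ.VG (onV S u)) (HF := fun _ => ULift.{u} (Multiplicative ℤ))
    (GE := fun e => ℬ.EG e.2) (φF := fun f => f.2.toCircle g) (φE := fun e => ℬ.φτ e.2)
    (fun f => ⟨onV S f.1, onE S f.2⟩) (K.onVG n u) (K.onVG_injective u)
    (fun f => K.onEG f.2) (fun f => (K.onEG_bijective inc f.2).2) (fun f => 1)
    (fun f x => K.comm_τ inc f.2 x) ?_ ?_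
  · rintro ⟨_, ⟨i, j, p, m, hm⟩⟩ ⟨_, ⟨i', _, _, m', hm'⟩⟩ h hπ -
    have hi : Sum.inl i = (Sum.inl i' : Fin 3 ⊕ Fin 2) :=
      S.vertices.1 (congrArg Sigma.fst hπ)
    obtain rfl : i = i' := Sum.inl_injective hi
    subst hm hm'
    rfl
  · rintro ⟨w, e⟩ y
    obtain ⟨w, rfl⟩ := S.vertices.2 w
    rcases w with i | j'
    · rcases u with ⟨i', m⟩ | ⟨j, p⟩
      · exact ((S.no_edge_surf i i').false e).elim
      · obtain rfl : e = S.edge i j := S.edge_unique i j e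
        exact ⟨⟨_, .mk i j p _ rfl⟩, 1, rfl, (S.φτ_bijective i j).2 _⟩
    · exact ((S.no_edge_cyc j' _).false e).elim

variable [NeZero n] [Nonempty M]
    (hconn : ∀ v w : CoverVertex.{u} M L,
      Relation.EqvGen (fun a b => Nonempty (CoverEdge inc a b)) v w)

/-- The covering of a standard branched surface. -/
def covering : Covering (cyclicCoverGraph g inc hconn) ℬ where
  onV := onV S
  onE := onE S
  onVG := K.onVG n
  onEG := K.onEG
  onVG_injective := K.onVG_injective
  onEG_injective e := (K.onEG_bijective inc e).1
  δι := K.δι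
  δτ _ := 1
  comm_ι := K.comm_ι inc
  comm_τ := K.comm_τ inc
  bijective_ι u := by
    obtain ⟨Φ, hΦ, hbij⟩ := K.bijective_ι inc u
    exact ⟨Φ, fun w f h => hΦ ⟨w, f⟩ h, hbij⟩
  bijective_τ u := by
    obtain ⟨Φ, hΦ, hbij⟩ := K.bijective_τ inc u
    exact ⟨Φ, fun w f h => hΦ ⟨w, f⟩ h, hbij⟩

theorem covering_isFinite [Finite M] [Finite L] : (K.covering inc hconn).IsFinite := by
  have hV : Finite (CoverVertex.{u} M L) :=
    Finite.of_surjective (α := (Fin 3 × M) ⊕ (Fin 2 × L))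
      (Sum.elim (fun x => .surf x.1 x.2) (fun x => .cyc x.1 x.2)) (by
        rintro (⟨i, m⟩ | ⟨j, p⟩)
        · exact ⟨.inl (i, m), rfl⟩
        · exact ⟨.inr (j, p), rfl⟩)
  refine ⟨fun v => Subtype.finite (α := CoverVertex.{u} M L), ?_⟩
  rintro (⟨i, m⟩ | ⟨j, p⟩)
  · have hle : ((handleChar (g i) n).comp (K.σ i).toMonoidHom).ker ≤
        (K.onVG n (CoverVertex.surf (L := L) i m)).range := by
      intro x hx
      refine ⟨ULift.up ⟨K.σ i x, hx⟩, ?_⟩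
      exact (K.σ i).symm_apply_apply x
    have := Subgroup.finiteIndex_ker ((handleChar (g i) n).comp (K.σ i).toMonoidHom)
    exact @Subgroup.finiteIndex_of_le _ _ _ _ this hle
  · have htop : (K.onVG n (CoverVertex.cyc (M := M) j p)).range = ⊤ :=
      MonoidHom.range_eq_top.mpr ((S.circle j).surjective.comp MulEquiv.ulift.surjective)
    change (K.onVG n (CoverVertex.cyc (M := M) j p)).range.FiniteIndex
    rw [htop]
    infer_instance

end StandardBranchedSurface.Marking

end Cover

/-! ### The homology of the cover -/

theorem ZMod.sum_range_natCast {A : Type*} [AddCommMonoid A] {n : ℕ} [NeZero n] (u : ZMod n → A) :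
    ∑ l ∈ Finset.range n, u l = ∑ k, u k := by
  refine Finset.sum_nbij' (fun l => (l : ZMod n)) ZMod.val (by simp) ?_ ?_ (by simp) (by simp)
  · intro k _
    exact Finset.mem_range.mpr (ZMod.val_lt k)
  · intro l hl
    exact ZMod.val_cast_of_lt (Finset.mem_range.mp hl)

/-- Partial sums of `u` satisfy the recursion also at the wrap-around from `n - 1` to `0`, because
the total sum vanishes. This lets the classes of the lifts of `b₀` be indexed by `ZMod n`. -/
theorem ZMod.sum_range_val_add_one {A : Type*} [AddCommGroup A] {n : ℕ} [NeZero n]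
    {u : ZMod n → A} (hu : ∑ k, u k = 0) (k : ZMod n) :
    ∑ l ∈ Finset.range (k + 1).val, u l = ∑ l ∈ Finset.range k.val, u l + u k := by
  have hk : u k = u (k.val : ZMod n) := by simp
  rw [hk, ← Finset.sum_range_succ]
  rcases lt_or_ge (k.val + 1) n with h | h
  · have h1 : k + 1 = ((k.val + 1 : ℕ) : ZMod n) := by simp
    rw [h1, ZMod.val_cast_of_lt h]
  · have hn : k.val + 1 = n := le_antisymm (ZMod.val_lt k) h
    have h0 : k + 1 = 0 := by
      have : ((k.val + 1 : ℕ) : ZMod n) = 0 := by rw [hn]; simp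
      simpa using this
    rw [h0, hn, ZMod.sum_range_natCast, hu]
    simp

section Incidence

variable {M L : Type} {n : ℕ} (inc : Fin 3 → L ≃ M × ZMod n)

/-- The quotient of the free abelian group on the points by the sums over lines. -/
abbrev PointQuotient : Type := IncidenceQuotient fun i p => (inc i p).1

variable [DecidableEq L]

/-- The class of a point. -/
def PointQuotient.point (p : L) : PointQuotient inc :=
  QuotientAddGroup.mk (Pi.single p (1 : ℤ))

theorem PointQuotient.mk_eq_sum [Fintype L] (f : L → ℤ) :
    (QuotientAddGroup.mk f : PointQuotient inc) = ∑ p, f p • PointQuotient.point inc p := by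
  change _ = ∑ p, f p • QuotientAddGroup.mk' _ (Pi.single p (1 : ℤ))
  simp only [← map_zsmul]
  rw [← map_sum]
  congr 1
  ext q
  simp [Finset.sum_apply, Pi.single_apply]

theorem PointQuotient.sum_point [NeZero n] (i : Fin 3) (m : M) :
    ∑ k, PointQuotient.point inc ((inc i).symm (m, k)) = 0 := by
  classical
  change ∑ k, QuotientAddGroup.mk' _ (Pi.single ((inc i).symm (m, k)) 1 : L → ℤ) = 0
  rw [← map_sum, QuotientAddGroup.mk'_apply, QuotientAddGroup.eq_zero_iff]
  -- The image of this basis function is the indicator of the line `(i, m)`.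
  refine ⟨Pi.single i (Pi.single m 1), ?_⟩
  ext p
  obtain ⟨⟨m', k'⟩, rfl⟩ := (inc i).symm.surjective p
  have h1 : incidenceMap (fun i p => (inc i p).1) (Pi.single i (Pi.single m (1 : ℤ)))
      ((inc i).symm (m', k')) = if m' = m then 1 else 0 := by
    simp only [incidenceMap, AddMonoidHom.coe_mk, ZeroHom.coe_mk]
    rw [Finset.sum_eq_single i]
    · simp [Pi.single_apply]
    · intro i' _ hi
      simp [Pi.single_eq_of_ne hi]
    · simp
  rw [h1, Finset.sum_apply]
  simp only [Pi.single_apply, EmbeddingLike.apply_eq_iff_eq, Prod.mk.injEq]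
  by_cases h : m' = m <;> simp [h]

variable [NeZero n] [Fintype M] [Fintype L]

/-- The homomorphism from the incidence quotient given by the images of the points. -/
def PointQuotient.lift {A : Type*} [AddCommGroup A] (ω : L → A)
    (hω : ∀ i m, ∑ k, ω ((inc i).symm (m, k)) = 0) : PointQuotient inc →+ A :=
  QuotientAddGroup.lift _
    { toFun := fun f : L → ℤ => ∑ p, f p • ω p
      map_zero' := by simp
      map_add' := fun f h => by simp [add_smul, Finset.sum_add_distrib] } (by
    rintro _ ⟨F, rfl⟩
    change ∑ p, (∑ i, F i (inc i p).1) • ω p = 0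
    simp only [Finset.sum_smul]
    rw [Finset.sum_comm]
    refine Finset.sum_eq_zero fun i _ => ?_
    rw [← Equiv.sum_comp (inc i).symm, Fintype.sum_prod_type]
    refine Finset.sum_eq_zero fun m _ => ?_
    simp [← Finset.smul_sum, hω])

theorem PointQuotient.lift_point {A : Type*} [AddCommGroup A] (ω : L → A)
    (hω : ∀ i m, ∑ k, ω ((inc i).symm (m, k)) = 0) (p : L) :
    PointQuotient.lift inc ω hω (PointQuotient.point inc p) = ω p := by
  change ∑ q, (Pi.single p (1 : ℤ) : L → ℤ) q • ω q = ω p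
  rw [Finset.sum_eq_single p]
  · simp
  · intro q _ hq
    simp [Pi.single_eq_of_ne hq]
  · simp

end Incidence

/-! ### The abelianized path group of the cover in coordinates. -/

section Homology

variable {M L : Type} {n : ℕ} (g : Fin 3 → ℕ) (inc : Fin 3 → L ≃ M × ZMod n)

namespace CoverHomology

variable [Nonempty M]
    (hconn : ∀ v w : CoverVertex.{u} M L,
      Relation.EqvGen (fun a b => Nonempty (CoverEdge inc a b)) v w)

/-- The abelianized path group of the cover. -/
abbrev PathAb : Type u := Additive (Abelianization (cyclicCoverGraph g inc hconn).PathGroup)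

/-- The homomorphism from a vertex group to the abelianized path group. -/
def vertexClass (v : CoverVertex.{u} M L) :
    v.Grp g n →* Abelianization (cyclicCoverGraph g inc hconn).PathGroup :=
  Abelianization.of.comp ((cyclicCoverGraph g inc hconn).eltHom v)

/-- The class of a circle in the abelianized path group. -/
def circleClass (j : Fin 2) (p : L) : PathAb g inc hconn :=
  .ofMul (vertexClass g inc hconn (.cyc j p) (ULift.up (.ofAdd 1)))

/-- The homomorphism from the vertex group of a surface to the abelianized path group. -/
def surfaceClass (i : Fin 3) (m : M) :
    CyclicCover (g i) n →* Abelianization (cyclicCoverGraph g inc hconn).PathGroup :=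
  (vertexClass g inc hconn (.surf i m)).comp MulEquiv.ulift.symm.toMonoidHom

/-- The stable letter cancels in the abelianization, so an edge relation just identifies the
boundary component with its circle. -/
theorem surfaceClass_boundaryLift (i : Fin 3) (j : Fin 2) (p : L) :
    .ofMul (surfaceClass g inc hconn i (inc i p).1
      (CyclicCover.boundaryLift n j (inc i p).2.val)) = circleClass g inc hconn j p := by
  have h := GraphOfGroups.letter_mul_elt (𝒢 := cyclicCoverGraph g inc hconn)
    (CoverEdge.mk i j p _ rfl) (ULift.up (.ofAdd 1))
  have h' := congrArg Abelianization.of h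
  rw [map_mul, map_mul, mul_comm, mul_left_inj] at h'
  refine Eq.trans ?_ (congrArg Additive.ofMul h').symm
  change _ = Additive.ofMul (surfaceClass g inc hconn i (inc i p).1
    (CyclicCover.boundaryLift n j (inc i p).2.val ^ (1 : ℤ)))
  rw [zpow_one]

theorem surfaceClass_c_zero (i : Fin 3) (m : M) (k : ZMod n) :
    .ofMul (surfaceClass g inc hconn i m (CyclicCover.lift n (.c 0) k.val)) =
      circleClass g inc hconn 0 ((inc i).symm (m, k)) := by
  have := surfaceClass_boundaryLift g inc hconn i 0 ((inc i).symm (m, k))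
  rw [Equiv.apply_symm_apply] at this
  exact this

theorem surfaceClass_c_one (i : Fin 3) (m : M) (k : ZMod n) :
    .ofMul (surfaceClass g inc hconn i m (CyclicCover.lift n (.c 1) k.val)) =
      -circleClass g inc hconn 1 ((inc i).symm (m, k)) := by
  have := surfaceClass_boundaryLift g inc hconn i 1 ((inc i).symm (m, k))
  rw [Equiv.apply_symm_apply] at this
  rw [← this]
  change _ = -Additive.ofMul (surfaceClass g inc hconn i m (CyclicCover.lift n (.c 1) k.val)⁻¹)
  rw [map_inv, ofMul_inv, neg_neg]

/-- The classes of the points in the abelianized path group. -/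
def pointClass (p : L) : PathAb g inc hconn :=
  circleClass g inc hconn 0 p - circleClass g inc hconn 1 p

theorem surfaceClass_b₀ [NeZero n] (i : Fin 3) (m : M) (t : ℕ) :
    (.ofMul (surfaceClass g inc hconn i m (CyclicCover.lift n .b₀ t)) : PathAb g inc hconn) =
      .ofMul (surfaceClass g inc hconn i m (CyclicCover.lift n .b₀ 0)) -
        ∑ l ∈ Finset.range t, pointClass g inc hconn ((inc i).symm (m, (l : ZMod n))) := by
  induction t with
  | zero => simp
  | succ t ih =>
    have h := CyclicCover.map_lift_b₀_add_one (surfaceClass g inc hconn i m) t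
    have hval : ((t : ℤ) : ZMod n) = (((t : ZMod n).val : ℤ) : ZMod n) := by simp
    rw [CyclicCover.map_lift_eq_of_intCast_eq _ (.c 0) hval,
      CyclicCover.map_lift_eq_of_intCast_eq _ (.c 1) hval] at h
    have h' := congrArg (Additive.ofMul (α := Abelianization _)) h
    rw [ofMul_mul, ofMul_mul, surfaceClass_c_zero, surfaceClass_c_one, ih] at h'
    rw [Finset.sum_range_succ, ← sub_sub, ← h', pointClass]
    push_cast
    abel

/-- After `n` steps around the cyclic cover the class of the lift of `b₀` returns to itself, having
changed by the sum over the whole line. -/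
theorem sum_pointClass [NeZero n] (i : Fin 3) (m : M) :
    ∑ k, pointClass g inc hconn ((inc i).symm (m, k)) = 0 := by
  have h := surfaceClass_b₀ g inc hconn i m n
  rw [CyclicCover.map_lift_eq_of_intCast_eq (k := n) (l := 0) _ .b₀ (by simp),
    ZMod.sum_range_natCast (fun k => pointClass g inc hconn ((inc i).symm (m, k)))] at h
  exact sub_eq_self.mp h.symm

end CoverHomology

variable [NeZero n] [DecidableEq L]

/-- Generators of the free part of the abelianized path group of the cover. -/
inductive CoverCoord (M L : Type) (n : ℕ) (g : Fin 3 → ℕ) : Type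
  | root (i : Fin 3) (m : M)
  | base (i : Fin 3) (m : M)
  | a (i : Fin 3) (m : M) (l : Fin (g i)) (k : ZMod n)
  | b (i : Fin 3) (m : M) (l : Fin (g i)) (k : ZMod n)
  | circle (p : L)
  | edge (i : Fin 3) (j : Fin 2) (p : L)

instance [Finite M] [Finite L] : Finite (CoverCoord M L n g) :=
  Finite.of_surjective
    (α := (Fin 3 × M) ⊕ (Fin 3 × M) ⊕ (Σ i, M × Fin (g i) × ZMod n) ⊕
      (Σ i, M × Fin (g i) × ZMod n) ⊕ L ⊕ (Fin 3 × Fin 2 × L))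
    (Sum.elim (fun x => .root x.1 x.2) <| Sum.elim (fun x => .base x.1 x.2) <|
      Sum.elim (fun x => .a x.1 x.2.1 x.2.2.1 x.2.2.2) <|
      Sum.elim (fun x => .b x.1 x.2.1 x.2.2.1 x.2.2.2) <|
      Sum.elim .circle fun x => .edge x.1 x.2.1 x.2.2) (by
    rintro (⟨i, m⟩ | ⟨i, m⟩ | ⟨i, m, l, k⟩ | ⟨i, m, l, k⟩ | p | ⟨i, j, p⟩)
    · exact ⟨.inl (i, m), rfl⟩
    · exact ⟨.inr (.inl (i, m)), rfl⟩
    · exact ⟨.inr (.inr (.inl ⟨i, m, l, k⟩)), rfl⟩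
    · exact ⟨.inr (.inr (.inr (.inl ⟨i, m, l, k⟩))), rfl⟩
    · exact ⟨.inr (.inr (.inr (.inr (.inl p)))), rfl⟩
    · exact ⟨.inr (.inr (.inr (.inr (.inr (i, j, p))))), rfl⟩)

/-- The abelianized path group of the cover, in coordinates. -/
abbrev CoverHomology : Type := PointQuotient inc × (CoverCoord M L n g →₀ ℤ)

namespace CoverHomology

/-- A generator of the free part. -/
noncomputable def free (x : CoverCoord M L n g) : CoverHomology g inc := (0, Finsupp.single x 1)

/-- The class of a point. -/
def point (p : L) : CoverHomology g inc := (PointQuotient.point inc p, 0)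

theorem sum_point (i : Fin 3) (m : M) : ∑ k, point g inc ((inc i).symm (m, k)) = 0 := by
  change ∑ k, AddMonoidHom.inl (PointQuotient inc) (CoverCoord M L n g →₀ ℤ)
    (PointQuotient.point inc ((inc i).symm (m, k))) = 0
  rw [← map_sum, PointQuotient.sum_point, map_zero]

/-- The classes of the circles. -/
noncomputable def circle (j : Fin 2) (p : L) : CoverHomology g inc :=
  -- The second circle over `p` is taken as free generator; the first exceeds it by the point `p`.
  ![point g inc p + free g inc (.circle p), free g inc (.circle p)] j

/-- The classes of the generators of the vertex groups of surfaces. -/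
noncomputable def values (i : Fin 3) (m : M) : PuncturedGen (g i) → ZMod n → CoverHomology g inc
  | .a l, k => free g inc (.a i m l k)
  | .b l, k => free g inc (.b i m l k)
  -- By `map_lift_b₀_add_one` consecutive lifts of `b₀` differ by a point, so only the lift at `0`
  -- is free.
  | .b₀, k => free g inc (.base i m) -
      ∑ l ∈ Finset.range k.val, point g inc ((inc i).symm (m, (l : ZMod n)))
  | .c j, k => ![circle g inc 0 ((inc i).symm (m, k)), -circle g inc 1 ((inc i).symm (m, k))] j

theorem values_relation (i : Fin 3) (m : M) (k : ZMod n) :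
    values g inc i m .b₀ (k + 1) + values g inc i m (.c 0) k + values g inc i m (.c 1) k =
      values g inc i m .b₀ k := by
  simp only [values, circle, Matrix.cons_val_zero, Matrix.cons_val_one]
  rw [ZMod.sum_range_val_add_one (u := fun k => point g inc ((inc i).symm (m, k)))
    (sum_point g inc i m)]
  abel

/-- The homomorphisms from the vertex groups. -/
noncomputable def vertexHom :
    ∀ v : CoverVertex.{u} M L, v.Grp g n →* Multiplicative (CoverHomology g inc)
  | .surf i m => (CyclicCover.homOfValues (free g inc (.root i m)) (values g inc i m)
      (values_relation g inc i m)).comp MulEquiv.ulift.toMonoidHom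
  | .cyc j p => (zpowersHom _ (.ofAdd (circle g inc j p))).comp MulEquiv.ulift.toMonoidHom

/-- The classes of the stable letters. -/
noncomputable def edgeClass : ∀ {v w : CoverVertex.{u} M L}, CoverEdge inc v w →
    Multiplicative (CoverHomology g inc)
  | _, _, .mk i j p _ _ => .ofAdd (free g inc (.edge i j p))

theorem homOfValues_boundaryLift (i : Fin 3) (m : M) (j : Fin 2) (k : ZMod n) :
    CyclicCover.homOfValues (free g inc (.root i m)) (values g inc i m)
      (values_relation g inc i m) (CyclicCover.boundaryLift n j k.val) =
      .ofAdd (circle g inc j ((inc i).symm (m, k))) := by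
  fin_cases j
  · refine (CyclicCover.homOfValues_lift _ _ _ _ _).trans ?_
    simp [values]
  · refine (map_inv _ _).trans ?_
    rw [CyclicCover.homOfValues_lift]
    simp [values]

theorem edgeClass_mul {v w : CoverVertex.{u} M L} (e : CoverEdge inc v w)
    (x : ULift.{u} (Multiplicative ℤ)) :
    edgeClass g inc e * vertexHom g inc w (e.toCircle g x) =
      vertexHom g inc v (e.attach g x) * edgeClass g inc e := by
  rw [mul_comm]
  congr 1
  rcases e with ⟨i, j, p, m, rfl⟩
  change Multiplicative.ofAdd (circle g inc j p) ^ x.down.toAdd =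
    CyclicCover.homOfValues _ _ _ (CyclicCover.boundaryLift n j ((inc i p).2.val : ℤ) ^
      x.down.toAdd)
  rw [map_zpow, homOfValues_boundaryLift]
  simp

variable [Nonempty M]
    (hconn : ∀ v w : CoverVertex.{u} M L,
      Relation.EqvGen (fun a b => Nonempty (CoverEdge inc a b)) v w)

/-- The map from the path group of the cover to its abelianization in coordinates. -/
noncomputable def ofPath :
    (cyclicCoverGraph g inc hconn).PathGroup →* Multiplicative (CoverHomology g inc) :=
  GraphOfGroups.PathGroup.lift (𝒢 := cyclicCoverGraph g inc hconn)
    (vertexHom g inc) (edgeClass g inc) (fun _ _ => edgeClass_mul g inc)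

theorem ofPath_elt (v : CoverVertex.{u} M L) (x : v.Grp g n) :
    ofPath g inc hconn ((cyclicCoverGraph g inc hconn).elt v x) = vertexHom g inc v x :=
  GraphOfGroups.PathGroup.lift_elt (𝒢 := cyclicCoverGraph g inc hconn) _ v x

theorem ofPath_letter {v w : CoverVertex.{u} M L} (e : CoverEdge inc v w) :
    ofPath g inc hconn ((cyclicCoverGraph g inc hconn).letter e) = edgeClass g inc e :=
  GraphOfGroups.PathGroup.lift_letter (𝒢 := cyclicCoverGraph g inc hconn) _ e

/-- The classes of the free generators in the abelianized path group. -/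
def coordClass : CoverCoord M L n g → PathAb g inc hconn
  | .root i m => .ofMul (surfaceClass g inc hconn i m (CyclicCover.root _ n))
  | .base i m => .ofMul (surfaceClass g inc hconn i m (CyclicCover.lift n .b₀ 0))
  | .a i m l k => .ofMul (surfaceClass g inc hconn i m (CyclicCover.lift n (.a l) k.val))
  | .b i m l k => .ofMul (surfaceClass g inc hconn i m (CyclicCover.lift n (.b l) k.val))
  | .circle p => circleClass g inc hconn 1 p
  | .edge i j p => .ofMul (Abelianization.of
      ((cyclicCoverGraph g inc hconn).letter (CoverEdge.mk i j p _ rfl)))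

/-- A point is the difference of the two circles over it, and circles are elements of vertex groups;
the quotient by lines is therefore reached without stable letters, as `exists_H₁_addEquiv` requires.
-/
theorem exists_ofPath_eq [Fintype L] (q : PointQuotient inc) :
    ∃ y ∈ Subgroup.closure {z | ∃ v h, z = (cyclicCoverGraph g inc hconn).elt v h},
      ofPath g inc hconn y = .ofAdd (q, 0) := by
  obtain ⟨f, rfl⟩ := QuotientAddGroup.mk_surjective q
  set N := (Subgroup.closure {z | ∃ v h, z = (cyclicCoverGraph g inc hconn).elt v h}).map
    (ofPath g inc hconn)
  have hcircle : ∀ j p, Multiplicative.ofAdd (circle g inc j p) ∈ N := by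
    intro j p
    refine ⟨_, Subgroup.subset_closure ⟨.cyc j p, ULift.up (.ofAdd 1), rfl⟩, ?_⟩
    exact (ofPath_elt g inc hconn _ _).trans (zpow_one _)
  have hpoint : ∀ p, Multiplicative.ofAdd (point g inc p) ∈ N := by
    intro p
    have h := N.mul_mem (hcircle 0 p) (N.inv_mem (hcircle 1 p))
    rw [← ofAdd_neg, ← ofAdd_add] at h
    simpa [circle] using h
  have hq : ((QuotientAddGroup.mk f : PointQuotient inc), (0 : CoverCoord M L n g →₀ ℤ)) =
      ∑ p, f p • point g inc p := by
    rw [PointQuotient.mk_eq_sum]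
    change AddMonoidHom.inl (PointQuotient inc) (CoverCoord M L n g →₀ ℤ) _ = _
    rw [map_sum]
    simp only [map_zsmul]
    rfl
  change Multiplicative.ofAdd _ ∈ N
  rw [hq, ofAdd_sum]
  exact N.prod_mem fun p _ => by rw [ofAdd_zsmul]; exact N.zpow_mem (hpoint p) _

variable [Fintype M] [Fintype L]

/-- The map from the coordinates to the abelianized path group. -/
noncomputable def toPath : CoverHomology g inc →+ PathAb g inc hconn :=
  AddMonoidHom.coprod
    (PointQuotient.lift inc (pointClass g inc hconn) (sum_pointClass g inc hconn))
    (Finsupp.liftAddHom fun x => zmultiplesHom _ (coordClass g inc hconn x))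

@[simp]
theorem toPath_free (x : CoverCoord M L n g) :
    toPath g inc hconn (free g inc x) = coordClass g inc hconn x := by
  simp [toPath, free]

@[simp]
theorem toPath_point (p : L) :
    toPath g inc hconn (point g inc p) = pointClass g inc hconn p := by
  simp [toPath, point, PointQuotient.lift_point]

theorem toPath_circle (j : Fin 2) (p : L) :
    toPath g inc hconn (circle g inc j p) = circleClass g inc hconn j p := by
  fin_cases j
  · simp [circle, coordClass, pointClass]
  · simp [circle, coordClass]

theorem toPath_comp_homOfValues (i : Fin 3) (m : M) :
    (AddMonoidHom.toMultiplicativeLeft (toPath g inc hconn)).comp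
      (CyclicCover.homOfValues (free g inc (.root i m)) (values g inc i m)
        (values_relation g inc i m)) = surfaceClass g inc hconn i m := by
  apply CyclicCover.hom_ext_zmod
  · rw [MonoidHom.comp_apply, CyclicCover.homOfValues_root]
    exact toPath_free g inc hconn (.root i m)
  · intro s k
    rw [MonoidHom.comp_apply, CyclicCover.homOfValues_lift, Int.cast_natCast,
      ZMod.natCast_zmod_val]
    apply Additive.ofMul.injective
    change toPath g inc hconn (values g inc i m s k) = _
    rcases s with l | l | _ | j
    · exact toPath_free g inc hconn (.a i m l k)
    · exact toPath_free g inc hconn (.b i m l k)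
    · rw [surfaceClass_b₀, values, map_sub, map_sum, toPath_free]
      simp only [toPath_point]
      rfl
    · fin_cases j
      · refine Eq.trans ?_ (surfaceClass_c_zero g inc hconn i m k).symm
        exact toPath_circle g inc hconn 0 _
      · refine Eq.trans ?_ (surfaceClass_c_one g inc hconn i m k).symm
        rw [← toPath_circle, ← map_neg]
        rfl

theorem toPath_comp_zpowersHom (j : Fin 2) (p : L) :
    (AddMonoidHom.toMultiplicativeLeft (toPath g inc hconn)).comp
      (zpowersHom _ (.ofAdd (circle g inc j p))) =
      (vertexClass g inc hconn (.cyc j p)).comp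
        (MulEquiv.ulift.symm.toMonoidHom : Multiplicative ℤ →* ULift.{u} _) := by
  apply MonoidHom.ext_mint
  rw [MonoidHom.comp_apply, zpowersHom_apply, toAdd_ofAdd, zpow_one]
  exact toPath_circle g inc hconn j p

theorem toPath_ofPath_elt (v : CoverVertex.{u} M L) (x : v.Grp g n) :
    AddMonoidHom.toMultiplicativeLeft (toPath g inc hconn)
      (ofPath g inc hconn ((cyclicCoverGraph g inc hconn).elt v x)) =
      Abelianization.of ((cyclicCoverGraph g inc hconn).elt v x) := by
  rw [ofPath_elt]
  rcases v with ⟨i, m⟩ | ⟨j, p⟩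
  · exact DFunLike.congr_fun (toPath_comp_homOfValues g inc hconn i m) x.down
  · exact DFunLike.congr_fun (toPath_comp_zpowersHom g inc hconn j p) x.down

/-- This gives the injectivity of the coordinates on the abelianized path group. It is checked on
generators: the root and lifts for the surfaces, the generator of each circle, and the stable
letters. -/
theorem toPath_ofPath (x : (cyclicCoverGraph g inc hconn).PathGroup) :
    toPath g inc hconn (ofPath g inc hconn x).toAdd = .ofMul (Abelianization.of x) := by
  suffices h : (AddMonoidHom.toMultiplicativeLeft (toPath g inc hconn)).comp
      (ofPath g inc hconn) = Abelianization.of from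
    congrArg Additive.ofMul (DFunLike.congr_fun h x)
  apply GraphOfGroups.PathGroup.hom_ext
  · exact toPath_ofPath_elt g inc hconn
  · rintro _ _ ⟨i, j, p, m, rfl⟩
    refine (congrArg (AddMonoidHom.toMultiplicativeLeft (toPath g inc hconn))
      (ofPath_letter g inc hconn _)).trans ?_
    exact toPath_free g inc hconn (.edge i j p)

end CoverHomology

end Homology

/-! ### The cover given by a Latin square -/

section LatinCover

variable {M : Type} [AddCommGroup M] {n : ℕ}

/-- The incidence of circles and surfaces given by the addition table of `M`. -/
noncomputable def latinIncidence (e : M ≃ ZMod n) (i : Fin 3) : M × M ≃ M × ZMod n :=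
  Equiv.ofBijective (fun p => (latinLine i p, e (![p.2, p.1, p.1] i))) (by
    constructor
    · rintro ⟨x, y⟩ ⟨x', y'⟩ h
      simp only [Prod.mk.injEq, EmbeddingLike.apply_eq_iff_eq] at h
      obtain ⟨h1, h2⟩ := h
      fin_cases i
      · exact Prod.ext h1 h2
      · exact Prod.ext h2 h1
      · simp only [latinLine] at h1 h2
        have h3 : x = x' := h2
        have h4 : x + y = x' + y' := h1
        subst h3
        exact Prod.ext rfl (add_left_cancel h4)
    · rintro ⟨m, k⟩
      fin_cases i
      · exact ⟨(m, e.symm k), Prod.ext rfl (e.apply_symm_apply k)⟩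
      · exact ⟨(e.symm k, m), Prod.ext rfl (e.apply_symm_apply k)⟩
      · exact ⟨(e.symm k, m - e.symm k),
          Prod.ext (add_sub_cancel (e.symm k) m) (e.apply_symm_apply k)⟩)

theorem latinIncidence_connected (e : M ≃ ZMod n) (v w : CoverVertex.{u} M (M × M)) :
    Relation.EqvGen (fun a b => Nonempty (CoverEdge (latinIncidence e) a b)) v w := by
  have hedge : ∀ i j p, Relation.EqvGen
      (fun a b => Nonempty (CoverEdge.{u} (latinIncidence e) a b))
      (.surf i (latinLine i p)) (.cyc j p) :=
    fun i j p => .rel _ _ ⟨.mk i j p _ rfl⟩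
  have hcyc : ∀ j p, Relation.EqvGen
      (fun a b => Nonempty (CoverEdge.{u} (latinIncidence e) a b)) (.cyc j p) (.cyc 0 (0, 0)) := by
    rintro j ⟨x, y⟩
    -- Move along the row of `x` to `(x, 0)`, then along the column of `0` to `(0, 0)`.
    exact ((hedge 0 j (x, y)).symm.trans _ _ _ (hedge 0 0 (x, 0))).trans _ _ _
      ((hedge 1 0 (x, 0)).symm.trans _ _ _ (hedge 1 0 (0, 0)))
  have hall : ∀ v, Relation.EqvGen
      (fun a b => Nonempty (CoverEdge.{u} (latinIncidence e) a b)) v (.cyc 0 (0, 0)) := by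
    rintro (⟨i, m⟩ | ⟨j, p⟩)
    · obtain ⟨p, hp⟩ : ∃ p, latinLine i p = m := by
        obtain ⟨p, hp⟩ := (latinIncidence e i).surjective (m, 0)
        exact ⟨p, congrArg Prod.fst hp⟩
      subst hp
      exact (hedge i 0 p).trans _ _ _ (hcyc 0 p)
    · exact hcyc j p
  exact (hall v).trans _ _ _ (hall w).symm

end LatinCover

theorem mainTheorem5 (ℬ : GraphOfGroups.{u}) (hℬ : ℬ.IsStandardBranchedSurface)
    (M : Type*) [AddCommGroup M] [Finite M] :
    ∃ (ℬM : GraphOfGroups.{u}) (Φ : GraphOfGroups.Covering ℬM ℬ) (r : ℕ),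
      Φ.IsFinite ∧ ∀ v₀ : ℬM.V, Nonempty (ℬM.H₁ v₀ ≃+ M × (Fin r → ℤ)) := by
  classical
  obtain ⟨S⟩ := hℬ
  obtain ⟨g, ⟨K⟩⟩ := S.exists_marking
  -- The cover is indexed by types in the lowest universe, so `M` is replaced by a copy there.
  obtain ⟨N, _, ⟨eM⟩⟩ : ∃ (N : Type) (_ : AddCommGroup N), Nonempty (M ≃+ N) := by
    obtain ⟨κ, _, p, _, k, h⟩ := AddCommGroup.equiv_directSum_zmod_of_finite M
    exact ⟨_, _, h⟩
  have : Finite N := Finite.of_equiv M eM.toEquiv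
  have : Fintype N := Fintype.ofFinite N
  obtain ⟨n, hn⟩ : ∃ n, n = Nat.card N := ⟨_, rfl⟩
  have : NeZero n := ⟨hn ▸ Nat.card_pos.ne'⟩
  obtain ⟨d⟩ : Nonempty (N ≃+ (N →+ ZMod n)) := hn ▸ nonempty_addEquiv_addMonoidHom_zmod N
  -- Any bijection will do: it only orders the points along each line, and the quotient by lines
  -- does not depend on this order.
  have e : N ≃ ZMod n := Fintype.equivOfCardEq (by rw [ZMod.card, hn, Nat.card_eq_fintype_card])
  let 𝒞 : GraphOfGroups.{u} :=
    cyclicCoverGraph g (latinIncidence e) (latinIncidence_connected e)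
  -- The lines of `latinIncidence e` are definitionally those of `latinLine`, so the classes of
  -- characters live in this quotient.
  let ι : M →+ PointQuotient (latinIncidence e) :=
    characterClass.comp (eM.trans d).toAddMonoidHom
  have hH : ∀ v₀ : 𝒞.V, ∃ r : ℕ, Nonempty (𝒞.H₁ v₀ ≃+ M × (Fin r → ℤ)) := by
    intro v₀
    refine GraphOfGroups.exists_H₁_addEquiv (𝒢 := 𝒞)
      (CoverHomology.ofPath g (latinIncidence e) (latinIncidence_connected e)) ?_
      (CoverHomology.exists_ofPath_eq g _ _) ι
      (characterClass_injective.comp (eM.trans d).injective) ?_ v₀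
    · intro x hx
      have h := CoverHomology.toPath_ofPath g (latinIncidence e) (latinIncidence_connected e) x
      rw [hx, toAdd_one, map_zero] at h
      exact (Additive.ofMul.injective h).symm
    · intro q hq
      have hexp : ∀ x : N, n • x = 0 := fun x => by rw [hn]; exact card_nsmul_eq_zero'
      obtain ⟨f, hf⟩ := mem_range_characterClass hexp hq
      obtain ⟨m, rfl⟩ := (eM.trans d).surjective f
      exact ⟨m, hf⟩
  -- The rank from `hH` could vary with the base point, so it is fixed at one vertex and transported
  -- to the others.
  let u₀ : 𝒞.V := 𝒞.nonempty.some
  obtain ⟨r, ⟨E⟩⟩ := hH u₀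
  refine ⟨𝒞, K.covering _ _, r, K.covering_isFinite _ _, fun v₀ => ?_⟩
  obtain ⟨E'⟩ := GraphOfGroups.nonempty_H₁_addEquiv v₀ u₀
  exact ⟨E'.trans E⟩
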